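/- Let $\mathcal C$ be the complex vector space with basis the functionals $d(l,\lambda): f\mapsto f^{(l)}(\lambda)$ ($l\ge 0$, $\lambda\in\mathbb C$). A pair $W=(C,q)$ consists of a finite-dimensional subspace $C\subset\mathcal C$ and a monic polynomial $q$ of degree $M=\dim C$. Its tau function in the times $x=t_1$ and $t=t_2$ is, up to a non-zero constant, $$\tau_W(x,t)=e^{-\sum_r (xr+tr^2)}\,\det\bigl(c_i(z^{j}e^{xz+tz^2})\bigr)_{1\le i\le M,\;0\le j\le M-1},$$ where $c_1,\dots,c_M$ is a basis of $C$ and $r$ runs over the zeros of $q$ with multiplicity. For each $x$ with $\tau_W(x,0)\ne0$, the stationary wave function $z\mapsto\psi_W(x,z)$ is the unique function of the form $(1+\alpha_1(x)z^{-1}+\alpha_2(x)z^{-2}+\cdots)e^{xz}$ near $z=\infty$ such that $z\mapsto q(z)\psi_W(x,z)$ is entire and is annihilated by every $c\in C$. Call $W$ bispectral if $C$ has a basis $c_1,\dots,c_M$ such that $c_i$ involves only derivatives at a single point $\lambda_i$, and $q(z)=\prod_i(z-\lambda_i)$. A Calogero–Moser particle system $(\vec x,\vec y)$ is a finite unordered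 set of pairs $(x_i,y_i)\in\mathbb C^2$ with pairwise distinct positions $x_i$. It is the particle system of $W$ if for $t$ near $0$ the function $x\mapsto\tau_W(x,t)$ is a non-zero constant (depending on $t$) times $\prod_i(x-x_i(t))$, where $x_i(0)=x_i$ and $\frac12\frac{d}{dt}x_i(t)|_{t=0}=y_i$. The bispectral involution $\beta$ acts on particle systems as follows: $\beta(\vec x,\vec y)=(\vec\zeta,\vec\mu)$ means that there are bispectral $W,W'$ with $\psi_{W'}(x,z)=\psi_W(z,x)$ such that $(\vec x,\vec y)$ is the particle system of $W$ and $(\vec\zeta,\vec\mu)$ is the particle system of $W'$. **Theorem.** Let $\lambda_1,\dots,\lambda_n\in\mathbb C$ be pairwise distinct and let $\gamma_1,\dots,\gamma_n\in\mathbb C$. Suppose that $(\vec x,\vec y)$ is the particle system of the pair $W=(C,q)$ for which $C$ is spanned by the conditions $c_i(f)=f'(\lambda_i)+\gamma_if(\lambda_i)$, $1\le i\le n$, and $q(z)=\prod_i(z-\lambda_i)$. Then $\beta(\vec x,\vec y)$ exists and is unique, and it is the particle system $(\vec\zeta,\vec\mu)$ given by $$\zeta_i=\lambda_i,\qquad \mu_i=\gamma_i+\sum_{j\ne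 i}\frac1{\lambda_i-\lambda_j}\qquad(1\le i\le n).$$ -/

import Mathlib

open scoped Topology Polynomial

namespace CalogeroMoser

/-- The complex vector space with basis the symbols `d l z₀` (`l : ℕ`, `z₀ : ℂ`), where `d l z₀` is the
functional `f ↦ f⁽ˡ⁾(z₀)`. The index of `d l z₀` is the pair `(z₀, l)`. -/
def Condition : Type := (ℂ × ℕ) →₀ ℂ

noncomputable instance : AddCommGroup Condition := inferInstanceAs (AddCommGroup ((ℂ × ℕ) →₀ ℂ))

noncomputable instance : Module ℂ Condition := Finsupp.module (ℂ × ℕ) ℂ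

/-- The functional `d l z₀ : f ↦ f⁽ˡ⁾(z₀)`. -/
noncomputable def d (l : ℕ) (z₀ : ℂ) : Condition := Finsupp.single (z₀, l) 1

/-- The coefficient of `d l z₀` in a condition. -/
noncomputable def coeff (l : ℕ) (z₀ : ℂ) : Condition →ₗ[ℂ] ℂ where
  toFun c := Finsupp.toFun c (z₀, l)
  map_add' _ _ := rfl
  map_smul' _ _ := rfl

theorem coeff_d (l l' : ℕ) (z₀ z₁ : ℂ) : coeff l z₀ (d l' z₁) = if l' = l ∧ z₁ = z₀ then 1 else 0 := by
  classical
  have h : coeff l z₀ (d l' z₁) = (Finsupp.single (z₁, l') (1 : ℂ)) (z₀, l) := rfl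
  rw [h]
  simp [Finsupp.single_apply, and_comm]

/-- The value `c(f)` of a differential condition on a function. -/
noncomputable def Condition.apply (c : Condition) (f : ℂ → ℂ) : ℂ :=
  Finsupp.sum (show (ℂ × ℕ) →₀ ℂ from c) fun p a => a * iteratedDeriv p.2 f p.1

/-- The conditions that involve only derivatives at the point `z₀`. -/
noncomputable def conditionsAt (z₀ : ℂ) : Submodule ℂ Condition :=
  Submodule.span ℂ (Set.range fun l : ℕ => d l z₀)

/-- A point `(C, q)` of the dual Grassmannian: a finite-dimensional space of conditions together with a
monic polynomial of degree `dim C`. -/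
structure DualPoint where
  C : Submodule ℂ Condition
  finiteDimensional : FiniteDimensional ℂ C
  q : ℂ[X]
  monic : q.Monic
  natDegree_eq : q.natDegree = Module.finrank ℂ C

namespace DualPoint

/-- `f` belongs to the (completed) space `W = q⁻¹ V_C` attached to `(C, q)`: `q f` is an entire function
satisfying all conditions in `C`. The values of `f` at the zeros of `q` play no role. -/
def Mem (W : DualPoint) (f : ℂ → ℂ) : Prop :=
  ∃ F : ℂ → ℂ, Differentiable ℂ F ∧ (∀ c ∈ W.C, Condition.apply c F = 0) ∧
    ∀ z, W.q.eval z ≠ 0 → f z = F z / W.q.eval z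

/-- The tau function in the variables `x = t₁` and `t = t₂` (the other times are zero):
`det (c_i (z ^ j * exp (x z + t z²)))`, `0 ≤ j < dim C`, for a basis `c_i` of `C`, multiplied by the factor
`exp (- ∑ (x r + t r²))`, over the zeros `r` of `q`, that belongs to the gauge `q`.
It is defined up to a nonzero constant, through the choice of the basis. -/
noncomputable def tau (W : DualPoint) (x t : ℂ) : ℂ :=
  haveI := W.finiteDimensional
  Complex.exp (-(W.q.roots.map fun r => x * r + t * r ^ 2).sum) *
    Matrix.det (Matrix.of fun i j : Fin (Module.finrank ℂ W.C) =>
      Condition.apply (Module.finBasis ℂ W.C i : Condition)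
        fun z => z ^ (j : ℕ) * Complex.exp (x * z + t * z ^ 2))

/-- `ψ` is the stationary wave function of `W`: for each fixed `x` with `tau W x 0 ≠ 0`, the function
`ψ x` lies in `W` and has the form `(1 + α₁(x) z⁻¹ + α₂(x) z⁻² + ⋯) e^{xz}` near `z = ∞`.
(For an element of `W`, which is holomorphic near `∞`, the latter means that `ψ(x, z) e^{-xz} → 1`.) -/
def IsWaveFunction (W : DualPoint) (ψ : ℂ → ℂ → ℂ) : Prop :=
  ∀ x, W.tau x 0 ≠ 0 →
    W.Mem (ψ x) ∧
      Filter.Tendsto (fun z => ψ x z * Complex.exp (-(x * z))) (Bornology.cobounded ℂ) (𝓝 1)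

/-- The points giving rational solutions in the bispectral gauge: `C` has a basis `c_1, …, c_M` such that `c_i`
involves only derivatives at one point `λ_i`, and `q = ∏ (z - λ_i)`. -/
def IsBispectral (W : DualPoint) : Prop :=
  ∃ (M : ℕ) (lam : Fin M → ℂ) (c : Fin M → Condition),
    LinearIndependent ℂ c ∧ (∀ i, c i ∈ conditionsAt (lam i)) ∧
    W.C = Submodule.span ℂ (Set.range c) ∧
    W.q = ∏ i, (Polynomial.X - Polynomial.C (lam i))

/-- `ψ_{W'}(x, z) = ψ_W(z, x)` wherever both sides are defined: `W'` is the image of `W` under the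
bispectral involution. -/
def IsBispectralDual (W W' : DualPoint) : Prop :=
  ∃ ψ ψ' : ℂ → ℂ → ℂ, W.IsWaveFunction ψ ∧ W'.IsWaveFunction ψ' ∧
    ∀ x z, W'.tau x 0 ≠ 0 → W'.q.eval z ≠ 0 → W.tau z 0 ≠ 0 → W.q.eval x ≠ 0 →
      ψ' x z = ψ z x

end DualPoint

/-- A Calogero-Moser particle system: an unordered finite set of pairs (position, momentum) with pairwise
distinct positions. -/
@[ext]
structure ParticleSystem where
  particles : Finset (ℂ × ℂ)
  injOn : Set.InjOn Prod.fst (particles : Set (ℂ × ℂ))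

/-- The particle system `{(x_1, y_1), …, (x_n, y_n)}`. -/
noncomputable def ParticleSystem.ofVectors {n : ℕ} (x y : Fin n → ℂ) (hx : Function.Injective x) :
    ParticleSystem where
  particles := Finset.univ.image fun i => (x i, y i)
  injOn := by
    intro p hp r hr h
    simp only [Finset.coe_image, Finset.coe_univ, Set.image_univ, Set.mem_range] at hp hr
    obtain ⟨i, rfl⟩ := hp
    obtain ⟨j, rfl⟩ := hr
    rw [hx h]

/-- `S` is the particle system of `W`: its positions are the zeros, with multiplicity, of `x ↦ tau W x 0`,
and its momenta are half the velocities, at `t = 0`, of the zeros of `x ↦ tau W x t`. Here `ξ p t` is the position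
at time `t` of the particle which is `p = (x_i, y_i)` at time `0`. -/
def DualPoint.HasParticleSystem (W : DualPoint) (S : ParticleSystem) : Prop :=
  ∃ ξ : ℂ × ℂ → ℂ → ℂ,
    (∀ᶠ t in 𝓝 (0 : ℂ), ∃ a : ℂ, a ≠ 0 ∧ ∀ x, W.tau x t = a * ∏ p ∈ S.particles, (x - ξ p t)) ∧
    ∀ p ∈ S.particles, ξ p 0 = p.1 ∧ HasDerivAt (ξ p) (2 * p.2) 0

/-- The bispectral involution `β` on particle systems, as a relation (`β(S) = S'`): `S` is the particle system of
a bispectral point `W`, and `S'` is the particle system of the image of `W` under the bispectral involution. -/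
def BispectralInvolution (S S' : ParticleSystem) : Prop :=
  ∃ W W' : DualPoint, W.IsBispectral ∧ W'.IsBispectral ∧ W.IsBispectralDual W' ∧
    W.HasParticleSystem S ∧ W'.HasParticleSystem S'

/-- The condition `f ↦ f'(λ) + γ f(λ)`. -/
noncomputable def cuspCondition (lam gam : ℂ) : Condition := d 1 lam + gam • d 0 lam

theorem linearIndependent_cuspCondition {n : ℕ} (lam gam : Fin n → ℂ) (hlam : Function.Injective lam) :
    LinearIndependent ℂ fun i => cuspCondition (lam i) (gam i) := by
  rw [Fintype.linearIndependent_iff]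
  intro g hg i
  have h := congrArg (coeff 1 (lam i)) hg
  rw [map_sum, Finset.sum_eq_single i] at h
  · simpa [cuspCondition, coeff_d] using h
  · intro j _ hj
    have hne : lam j ≠ lam i := fun h => hj (hlam h)
    simp [cuspCondition, coeff_d, hne]
  · simp

/-- The point with dual Grassmannian coordinates `(λ, γ)`: the space of conditions is spanned by
`f'(λ_i) + γ_i f(λ_i)`, and `q = ∏ (z - λ_i)`. -/
noncomputable def DualPoint.ofCoordinates {n : ℕ} (lam gam : Fin n → ℂ) (hlam : Function.Injective lam) :
    DualPoint where
  C := Submodule.span ℂ (Set.range fun i => cuspCondition (lam i) (gam i))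
  finiteDimensional := FiniteDimensional.span_of_finite ℂ (Set.finite_range _)
  q := ∏ i, (Polynomial.X - Polynomial.C (lam i))
  monic := Polynomial.monic_prod_of_monic _ _ fun i _ => Polynomial.monic_X_sub_C _
  natDegree_eq := by
    rw [finrank_span_eq_card (linearIndependent_cuspCondition lam gam hlam)]
    simp

end CalogeroMoser

/-!
Let `Y` be the Calogero-Moser matrix of a particle system `(x, y)`, with diagonal entries `y i` and
off-diagonal entries `1 / (x i - x j)`, and let `CMSystem x y z a` be the linear system
`(z + Y) a = -(1, …, 1)`. The proof rests on the fact that this system appears twice.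

* For any point `W` with particle system `(x, y)` whose wave function is asymptotic to `exp (x z)`
  as `x → ∞`, Liouville's theorem gives `ψ(x, z) = exp (x z) (1 + ∑ i, a i / (x - x i))`, and `a`
  solves the system for `(x, y)` (`HasParticles.exists_cmSystem`). Indeed the tau function is a
  Wronskian of functions `f` with `f_t = f_xx` and the wave function is a bordered Wronskian
  divided by it and by `q`; a Plücker relation, proved by Cramer's rule
  (`wronskian_border_mul_wronskian`), gives the bilinear form of the Lax equation at the zeros of
  the tau function (`gaugedWave_bilinear`). Here the velocities of the zeros enter.
* For the point with coordinates `(λ, γ)`, the conditions `f'(λ_i) + γ_i f(λ_i) = 0` say that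
  `ψ(x, z) = exp (x z) (1 + ∑ i, b i / (z - λ_i))`, where `b` solves the system for `(λ, μ)` at the
  parameter `x`, with `μ_i = γ_i + ∑ j ≠ i, 1 / (λ_i - λ_j)` (`exists_cmSystem_ofCoordinates`).

Existence: if `(x, y)` is the particle system of `(λ, γ)`, then `ψ(z, x)` is the wave function of
the point with coordinates `(x, y_i - ∑ j ≠ i, 1 / (x_i - x_j))`, because both have a pole expansion
governed by the same matrix (`wave_ofCoordinates_dual`). Its poles in `x` are the `λ_i`, and
comparing the two linear systems for the residues there shows that its momenta are the `μ_i`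
(`hasParticles_dual`). The implicit function theorem makes its zeros move differentiably.

Uniqueness: for a dual pair the normalization of one wave function as `z → ∞` is the normalization
of the other one as `x → ∞`, so both have pole expansions in `x`. The particle system of `W`
determines its wave function, hence the poles and residues of the wave function of the dual point;
the residues are nonzero when the other variable is large, and the linear system then determines the
momenta (`ofVectors_eq_of_dual`).
-/

namespace CalogeroMoser

/-! ### Conditions applied to exponentials -/

/-- The function `z ↦ z ^ j * exp (x z + t z²)`, to which the conditions are applied. -/
noncomputable def powExp (j : ℕ) (x t z : ℂ) : ℂ :=
  z ^ j * Complex.exp (x * z + t * z ^ 2)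

theorem contDiff_powExp (j : ℕ) (x t : ℂ) {n : WithTop ℕ∞} : ContDiff ℂ n (powExp j x t) := by
  unfold powExp
  fun_prop

theorem deriv_powExp (j : ℕ) (x t : ℂ) :
    deriv (powExp j x t) = fun z => j * powExp (j - 1) x t z +
      (x * powExp j x t z + 2 * t * powExp (j + 1) x t z) := by
  funext z
  have h1 : HasDerivAt (fun z : ℂ => x * z + t * z ^ 2) (x + t * (2 * z)) z := by
    have := ((hasDerivAt_id z).const_mul x).add (((hasDerivAt_id z).pow 2).const_mul t)
    simpa using! this
  have h2 := (hasDerivAt_pow j z).mul h1.cexp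
  have h3 : deriv (powExp j x t) z = _ := h2.deriv
  rw [h3]
  simp only [powExp]
  ring

theorem iteratedDeriv_succ_powExp (l j : ℕ) (x t z : ℂ) :
    iteratedDeriv (l + 1) (powExp j x t) z = j * iteratedDeriv l (powExp (j - 1) x t) z +
      (x * iteratedDeriv l (powExp j x t) z + 2 * t * iteratedDeriv l (powExp (j + 1) x t) z) := by
  have h (j : ℕ) : ContDiffAt ℂ l (powExp j x t) z := (contDiff_powExp j x t).contDiffAt
  rw [iteratedDeriv_succ', deriv_powExp,
    iteratedDeriv_fun_add (contDiffAt_const.mul (h _))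
      ((contDiffAt_const.mul (h _)).add (contDiffAt_const.mul (h _))),
    iteratedDeriv_fun_add (contDiffAt_const.mul (h _)) (contDiffAt_const.mul (h _)),
    iteratedDeriv_const_mul_field, iteratedDeriv_const_mul_field, iteratedDeriv_const_mul_field]

/-- The linear form `(x, t) ↦ a x + b t`, the differential of a function with partial derivatives
`a` and `b`. -/
noncomputable def partials (a b : ℂ) : ℂ × ℂ →L[ℂ] ℂ :=
  a • ContinuousLinearMap.fst ℂ ℂ ℂ + b • ContinuousLinearMap.snd ℂ ℂ ℂ

@[simp] theorem partials_apply (a b : ℂ) (v : ℂ × ℂ) : partials a b v = a * v.1 + b * v.2 := rfl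

/-- Differentiating in `x` multiplies the exponential by `z`, and differentiating in `t` multiplies
it by `z²`; both commute with the derivatives in `z`. -/
theorem hasStrictFDerivAt_iteratedDeriv_powExp (l j : ℕ) (z : ℂ) (p : ℂ × ℂ) :
    HasStrictFDerivAt (fun p : ℂ × ℂ => iteratedDeriv l (powExp j p.1 p.2) z)
      (partials (iteratedDeriv l (powExp (j + 1) p.1 p.2) z)
        (iteratedDeriv l (powExp (j + 2) p.1 p.2) z)) p := by
  induction l generalizing j with
  | zero =>
    simp only [iteratedDeriv_zero, powExp]
    have h1 : HasStrictFDerivAt (fun p : ℂ × ℂ => p.1 * z + p.2 * z ^ 2)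
        (partials z (z ^ 2)) p := by
      have := ((hasStrictFDerivAt_fst (𝕜 := ℂ) (p := p)).mul_const z).add
        ((hasStrictFDerivAt_snd (𝕜 := ℂ) (p := p)).mul_const (z ^ 2))
      exact this
    refine (h1.cexp.const_mul (z ^ j)).congr_fderiv ?_
    ext <;> simp <;> ring
  | succ l ih =>
    simp only [iteratedDeriv_succ_powExp]
    have h := (((ih (j - 1)).const_mul (j : ℂ))).add
      (((hasStrictFDerivAt_fst (𝕜 := ℂ) (p := p)).mul (ih j)).add
        (((hasStrictFDerivAt_snd (𝕜 := ℂ) (p := p)).const_mul 2).mul (ih (j + 1))))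
    refine h.congr_fderiv ?_
    rcases j with _ | j
    · ext <;> simp <;> ring
    · ext <;> simp [add_assoc, Nat.reduceAdd] <;> ring

/-- A condition as a sum over its support, read as a finitely supported function of the pairs
`(z₀, l)`. -/
theorem Condition.apply_def (c : Condition) (f : ℂ → ℂ) :
    c.apply f = ∑ p ∈ Finsupp.support (show (ℂ × ℕ) →₀ ℂ from c),
      (show (ℂ × ℕ) →₀ ℂ from c) p * iteratedDeriv p.2 f p.1 := rfl

theorem Condition.apply_add (c c' : Condition) (f : ℂ → ℂ) :
    (c + c').apply f = c.apply f + c'.apply f :=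
  Finsupp.sum_add_index' (f := (show (ℂ × ℕ) →₀ ℂ from c)) (g := (show (ℂ × ℕ) →₀ ℂ from c'))
    (by simp) (by intros; ring)

theorem Condition.apply_smul (a : ℂ) (c : Condition) (f : ℂ → ℂ) :
    (a • c).apply f = a * c.apply f := by
  have h := Finsupp.sum_smul_index (g := (show (ℂ × ℕ) →₀ ℂ from c)) (b := a)
    (h := fun p a => a * iteratedDeriv p.2 f p.1) (by simp)
  refine h.trans ?_
  rw [Condition.apply, Finsupp.mul_sum]
  simp only [mul_assoc]

/-- The value of a condition on a fixed function, as a linear form in the condition. -/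
noncomputable def Condition.eval (f : ℂ → ℂ) : Condition →ₗ[ℂ] ℂ where
  toFun c := c.apply f
  map_add' c c' := c.apply_add c' f
  map_smul' a c := c.apply_smul a f

@[simp] theorem Condition.eval_apply (f : ℂ → ℂ) (c : Condition) : Condition.eval f c = c.apply f :=
  rfl

@[simp] theorem apply_d (l : ℕ) (z : ℂ) (f : ℂ → ℂ) : (d l z).apply f = iteratedDeriv l f z := by
  refine (Finsupp.sum_single_index (by simp)).trans ?_
  simp

theorem apply_cuspCondition (lam gam : ℂ) (f : ℂ → ℂ) :
    (cuspCondition lam gam).apply f = deriv f lam + gam * f lam := by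
  rw [cuspCondition, Condition.apply_add, Condition.apply_smul]
  simp

/-- Conditions are linear on smooth functions; smoothness excludes the junk values of
`iteratedDeriv`. -/
theorem Condition.apply_sum_mul (c : Condition) {ι : Type*} (s : Finset ι) (a : ι → ℂ)
    (f : ι → ℂ → ℂ) (hf : ∀ i n, ContDiff ℂ n (f i)) :
    c.apply (fun z => ∑ i ∈ s, a i * f i z) = ∑ i ∈ s, a i * c.apply (f i) := by
  simp only [Condition.apply_def, Finset.mul_sum]
  rw [Finset.sum_comm]
  refine Finset.sum_congr rfl fun p _ => ?_
  have h : iteratedDeriv p.2 (fun z => ∑ i ∈ s, a i * f i z) p.1 =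
      ∑ i ∈ s, a i * iteratedDeriv p.2 (f i) p.1 := by
    rw [iteratedDeriv_fun_sum (fun i _ => (contDiff_const.mul (hf i _)).contDiffAt)]
    exact Finset.sum_congr rfl fun i _ => by rw [iteratedDeriv_const_mul_field]
  rw [h, Finset.mul_sum]
  exact Finset.sum_congr rfl fun i _ => by ring

theorem hasStrictFDerivAt_apply_powExp (c : Condition) (j : ℕ) (p : ℂ × ℂ) :
    HasStrictFDerivAt (fun p : ℂ × ℂ => c.apply (powExp j p.1 p.2))
      (partials (c.apply (powExp (j + 1) p.1 p.2)) (c.apply (powExp (j + 2) p.1 p.2))) p := by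
  simp only [Condition.apply_def]
  refine (HasStrictFDerivAt.fun_sum fun q _ =>
    (hasStrictFDerivAt_iteratedDeriv_powExp q.2 j q.1 p).const_mul _).congr_fderiv ?_
  ext <;> simp

/-! ### Wronskian determinants -/

/-- The determinant of the matrix `c_i (z ^ (σ j) * exp (x z + t z²))`. For `σ j = j` it is the
Wronskian in `x` of the functions `c_i (exp (x z + t z²))`. -/
noncomputable def wronskian {N : ℕ} (c : Fin N → Condition) (σ : Fin N → ℕ) (x t : ℂ) : ℂ :=
  Matrix.det (Matrix.of fun i j => (c i).apply (powExp (σ j) x t))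

theorem wronskian_eq_zero {N : ℕ} (c : Fin N → Condition) (σ : Fin N → ℕ) (x t : ℂ) {i j : Fin N}
    (hij : i ≠ j) (h : σ i = σ j) : wronskian c σ x t = 0 :=
  Matrix.det_zero_of_column_eq hij fun k => by simp [h]

theorem wronskian_comp_swap {N : ℕ} (c : Fin N → Condition) (σ : Fin N → ℕ) (x t : ℂ) {i j : Fin N}
    (hij : i ≠ j) : wronskian c (σ ∘ Equiv.swap i j) x t = -wronskian c σ x t := by
  have h := Matrix.det_permute' (Equiv.swap i j)
    (Matrix.of fun i j => (c i).apply (powExp (σ j) x t))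
  rw [Equiv.Perm.sign_swap hij] at h
  simpa [wronskian, Matrix.submatrix] using h

theorem hasStrictFDerivAt_wronskian {N : ℕ} (c : Fin N → Condition) (σ : Fin N → ℕ) (p : ℂ × ℂ) :
    HasStrictFDerivAt (fun p : ℂ × ℂ => wronskian c σ p.1 p.2)
      (partials (∑ k, wronskian c (Function.update σ k (σ k + 1)) p.1 p.2)
        (∑ k, wronskian c (Function.update σ k (σ k + 2)) p.1 p.2)) p := by
  simp only [wronskian, Matrix.det_apply', Matrix.of_apply]
  refine (HasStrictFDerivAt.fun_sum fun π _ =>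
    (HasStrictFDerivAt.finsetProd fun i _ =>
      hasStrictFDerivAt_apply_powExp (c (π i)) (σ i) p).const_mul
        ((Equiv.Perm.sign π : ℤ) : ℂ)).congr_fderiv ?_
  have key (m : ℕ) (k : Fin N) (π : Equiv.Perm (Fin N)) :
      ∏ i, (c (π i)).apply (powExp (Function.update σ k (σ k + m) i) p.1 p.2) =
      (∏ i ∈ Finset.univ.erase k, (c (π i)).apply (powExp (σ i) p.1 p.2)) *
        (c (π k)).apply (powExp (σ k + m) p.1 p.2) := by
    rw [← Finset.prod_erase_mul _ _ (Finset.mem_univ k)]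
    congr 1
    · refine Finset.prod_congr rfl fun i hi => ?_
      rw [Function.update_of_ne (Finset.ne_of_mem_erase hi)]
    · rw [Function.update_self]
  simp only [key]
  ext
  · simp only [ContinuousLinearMap.coe_comp, Function.comp_apply, sum_apply,
      smul_apply, ContinuousLinearMap.inl_apply, partials_apply, smul_eq_mul,
      Finset.mul_sum]
    rw [mul_one, mul_zero, add_zero, Finset.sum_comm]
    exact Finset.sum_congr rfl fun _ _ => Finset.sum_congr rfl fun _ _ => by ring
  · simp only [ContinuousLinearMap.coe_comp, Function.comp_apply, sum_apply,
      smul_apply, ContinuousLinearMap.inr_apply, partials_apply, smul_eq_mul,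
      Finset.mul_sum]
    rw [mul_one, mul_zero, zero_add, Finset.sum_comm]
    exact Finset.sum_congr rfl fun _ _ => Finset.sum_congr rfl fun _ _ => by ring

theorem hasDerivAt_wronskian {N : ℕ} (c : Fin N → Condition) (σ : Fin N → ℕ) (x t : ℂ) :
    HasDerivAt (fun x => wronskian c σ x t)
      (∑ k, wronskian c (Function.update σ k (σ k + 1)) x t) x := by
  have h := (hasStrictFDerivAt_wronskian c σ (x, t)).hasFDerivAt.comp_hasDerivAt x
    ((hasDerivAt_id x).prodMk (hasDerivAt_const x t))
  simpa using! h

/-- The exponents `0, 1, …, m - 1, r`. -/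
def replaceLast (m r : ℕ) : Fin (m + 1) → ℕ :=
  Function.update Fin.val (Fin.last m) r

@[simp] theorem replaceLast_last (m r : ℕ) : replaceLast m r (Fin.last m) = r :=
  Function.update_self ..

@[simp] theorem replaceLast_castSucc (m r : ℕ) (j : Fin m) : replaceLast m r j.castSucc = j :=
  Function.update_of_ne (Fin.castSucc_lt_last j).ne ..

theorem replaceLast_of_ne (m r : ℕ) {j : Fin (m + 1)} (hj : j ≠ Fin.last m) :
    replaceLast m r j = j :=
  Function.update_of_ne hj ..

theorem replaceLast_self (m : ℕ) : replaceLast m m = Fin.val := by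
  simp [replaceLast, Function.update_eq_self_iff]

/-- Differentiating the Wronskian only shifts its last column: the other terms have two equal
columns. -/
theorem hasDerivAt_wronskian_val {m : ℕ} (c : Fin (m + 1) → Condition) (x t : ℂ) :
    HasDerivAt (fun x => wronskian c Fin.val x t) (wronskian c (replaceLast m (m + 1)) x t) x := by
  refine (hasDerivAt_wronskian c _ x t).congr_deriv ?_
  rw [Fintype.sum_eq_single (Fin.last m)]
  · rfl
  · intro k hk
    have hk' : (k : ℕ) < m := Fin.val_lt_last hk
    refine wronskian_eq_zero c _ x t (i := k) (j := ⟨k + 1, by omega⟩) ?_ ?_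
    · simp [Fin.ext_iff]
    · rw [Function.update_self, Function.update_of_ne (by simp [Fin.ext_iff])]

theorem wronskian_update_add_wronskian_update {m : ℕ} (c : Fin (m + 1) → Condition) (x t : ℂ)
    {k : Fin (m + 1)} (hk : k ≠ Fin.last m) :
    wronskian c (Function.update (replaceLast m (m + 1)) k (k + 1)) x t +
      wronskian c (Function.update Fin.val k (k + 2)) x t = 0 := by
  have hk' : (k : ℕ) < m := Fin.val_lt_last hk
  rcases Nat.lt_or_ge (k + 1) m with h | h
  · rw [wronskian_eq_zero c _ x t (i := k) (j := ⟨k + 1, by omega⟩),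
      wronskian_eq_zero c _ x t (i := k) (j := ⟨k + 2, by omega⟩), add_zero]
    · simp [Fin.ext_iff]
    · rw [Function.update_self, Function.update_of_ne (by simp [Fin.ext_iff])]
    · simp [Fin.ext_iff]
    · rw [Function.update_self, Function.update_of_ne (by simp [Fin.ext_iff]),
        replaceLast_of_ne _ _ (by simp [Fin.ext_iff]; omega)]
  · -- The two determinants differ by the transposition of the last two columns.
    have e : Function.update Fin.val k (k + 2) =
        Function.update (replaceLast m (m + 1)) k (k + 1) ∘ (Equiv.swap k (Fin.last m)) := by
      funext j
      rcases eq_or_ne j k with rfl | hjk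
      · simp [Function.update_of_ne hk.symm]; omega
      · rcases eq_or_ne j (Fin.last m) with rfl | hj
        · simp [Function.update_of_ne hjk]; omega
        · simp [Equiv.swap_apply_of_ne_of_ne hjk hj, Function.update_of_ne hjk,
            replaceLast_of_ne _ _ hj]
    rw [e, wronskian_comp_swap c _ x t hk, add_neg_cancel]

/-- The second `x`-derivative and the `t`-derivative of the Wronskian add up to twice the
determinant whose last column is shifted by two. -/
theorem sum_wronskian_update {m : ℕ} (c : Fin (m + 1) → Condition) (x t : ℂ) :
    (∑ k, wronskian c (Function.update (replaceLast m (m + 1)) k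
        (replaceLast m (m + 1) k + 1)) x t) +
      ∑ k, wronskian c (Function.update Fin.val k (k + 2)) x t =
    2 * wronskian c (replaceLast m (m + 2)) x t := by
  rw [← Finset.sum_add_distrib, Fintype.sum_eq_single (Fin.last m)]
  · simp [two_mul, replaceLast]
  · intro k hk
    rw [replaceLast_of_ne _ _ hk]
    exact wronskian_update_add_wronskian_update c x t hk

/-- The conditions `c_i` together with the evaluation at `z`. -/
noncomputable def border {N : ℕ} (c : Fin N → Condition) (z : ℂ) : Fin (N + 1) → Condition :=
  Fin.snoc (α := fun _ => Condition) c (d 0 z)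

@[simp] theorem border_last {N : ℕ} (c : Fin N → Condition) (z : ℂ) :
    border c z (Fin.last N) = d 0 z :=
  Fin.snoc_last (α := fun _ => Condition) _ _

@[simp] theorem border_castSucc {N : ℕ} (c : Fin N → Condition) (z : ℂ) (i : Fin N) :
    border c z i.castSucc = c i :=
  Fin.snoc_castSucc (α := fun _ => Condition) _ _ _

/-- Cramer's rule for the Wronskian bordered by the evaluation at `z`: if a combination of the
functions `powExp (e j)` satisfies all conditions `c_i`, then its value at `z` is proportional to
the bordered determinant. -/
theorem wronskian_border_mul {N : ℕ} (c : Fin N → Condition) (e : Fin (N + 1) → ℕ) (x t z : ℂ)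
    (v : Fin (N + 1) → ℂ) (hv : ∀ i, ∑ j, v j * (c i).apply (powExp (e j) x t) = 0)
    (k : Fin (N + 1)) :
    wronskian (border c z) e x t * v k =
      (-1) ^ (N + k : ℕ) * wronskian c (e ∘ k.succAbove) x t *
        ∑ j, v j * powExp (e j) x t z := by
  set A : Matrix (Fin (N + 1)) (Fin (N + 1)) ℂ := Matrix.of fun i j =>
    (border c z i).apply (powExp (e j) x t) with hA
  set κ := ∑ j, v j * powExp (e j) x t z
  have h1 : A.mulVec v = Pi.single (Fin.last N) κ := by
    funext i
    refine Fin.lastCases ?_ (fun i => ?_) i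
    · simp only [Matrix.mulVec, dotProduct, hA, Matrix.of_apply, border_last, apply_d,
        iteratedDeriv_zero, Pi.single_eq_same]
      exact Finset.sum_congr rfl fun j _ => mul_comm _ _
    · rw [Pi.single_eq_of_ne (Fin.castSucc_lt_last i).ne, ← hv i]
      simp only [Matrix.mulVec, dotProduct, hA, Matrix.of_apply, border_castSucc]
      exact Finset.sum_congr rfl fun j _ => mul_comm _ _
  have h2 : A.adjugate.mulVec (A.mulVec v) k = A.det * v k := by
    rw [Matrix.mulVec_mulVec, Matrix.adjugate_mul, Matrix.smul_mulVec, Matrix.one_mulVec]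
    rfl
  rw [h1, Matrix.mulVec_single, Pi.smul_apply, Matrix.col_apply,
    Matrix.adjugate_fin_succ_eq_det_submatrix] at h2
  have h3 : (A.submatrix (Fin.last N).succAbove k.succAbove).det =
      wronskian c (e ∘ k.succAbove) x t := by
    unfold wronskian
    congr 1
    ext i j
    simp [hA]
  have h4 : A.det = wronskian (border c z) e x t := rfl
  rw [← h4, ← h2, h3]
  simp

/-- The bilinear identity for Wronskians at a zero of the unbordered Wronskian. -/
theorem wronskian_border_mul_wronskian {m : ℕ} (c : Fin (m + 1) → Condition) (x t z : ℂ)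
    (h0 : wronskian c Fin.val x t = 0)
    (h1 : wronskian c (replaceLast m (m + 1)) x t ≠ 0) :
    wronskian (border c z) Fin.val x t * wronskian c (replaceLast m (m + 2)) x t =
      wronskian c (replaceLast m (m + 1)) x t *
        wronskian (border c z) (replaceLast (m + 1) (m + 2)) x t := by
  obtain ⟨s, hs0, hs⟩ := Matrix.exists_mulVec_eq_zero_iff.mpr h0
  have hs' (i) : ∑ j, s j * (c i).apply (powExp j x t) = 0 := by
    have := congrFun hs i
    simp only [Matrix.mulVec, dotProduct, Matrix.of_apply, Pi.zero_apply] at this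
    rw [← this]
    exact Finset.sum_congr rfl fun j _ => mul_comm _ _
  -- Otherwise the columns that survive in the derivative would be linearly dependent.
  have hlast : s (Fin.last m) ≠ 0 := by
    intro hm
    refine h1 (Matrix.exists_mulVec_eq_zero_iff.mp ⟨s, hs0, ?_⟩)
    funext i
    rw [Pi.zero_apply, ← hs' i]
    simp only [Matrix.mulVec, dotProduct, Matrix.of_apply]
    refine Finset.sum_congr rfl fun j _ => ?_
    rcases eq_or_ne j (Fin.last m) with rfl | hj
    · simp [hm]
    · rw [replaceLast_of_ne _ _ hj, mul_comm]
  have key (r : ℕ) := wronskian_border_mul c (replaceLast (m + 1) r) x t z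
    (Fin.snoc (α := fun _ => ℂ) s 0)
    (fun i => by
      rw [Fin.sum_univ_castSucc]
      simp [hs' i]) (Fin.castSucc (Fin.last m))
  have hcol (r : ℕ) : replaceLast (m + 1) r ∘ (Fin.castSucc (Fin.last m)).succAbove =
      replaceLast m r := by
    funext j
    refine Fin.lastCases ?_ (fun j => ?_) j
    · rw [Function.comp_apply, Fin.succAbove_castSucc_self, Fin.succ_last, replaceLast_last,
        replaceLast_last]
    · rw [Function.comp_apply, Fin.succAbove_castSucc_of_lt _ _ (Fin.castSucc_lt_last j),
        replaceLast_castSucc, replaceLast_castSucc]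
      rfl
  have hκ (r : ℕ) : ∑ j, (Fin.snoc (α := fun _ => ℂ) s 0) j *
      powExp (replaceLast (m + 1) r j) x t z = ∑ j, s j * powExp j x t z := by
    rw [Fin.sum_univ_castSucc]
    simp
  have k1 := key (m + 1)
  have k2 := key (m + 2)
  rw [hcol, hκ, Fin.snoc_castSucc] at k1 k2
  rw [replaceLast_self] at k1
  refine mul_right_cancel₀ hlast ?_
  linear_combination
    wronskian c (replaceLast m (m + 2)) x t * k1 - wronskian c (replaceLast m (m + 1)) x t * k2

/-! ### The bilinear equation at a zero of the tau function -/

theorem hasDerivAt_wronskian_time {N : ℕ} (c : Fin N → Condition) (σ : Fin N → ℕ) (x t : ℂ) :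
    HasDerivAt (fun t => wronskian c σ x t)
      (∑ k, wronskian c (Function.update σ k (σ k + 2)) x t) t := by
  have h := (hasStrictFDerivAt_wronskian c σ (x, t)).hasFDerivAt.comp_hasDerivAt t
    ((hasDerivAt_const t x).prodMk (hasDerivAt_id t))
  simpa using! h

/-- The Wronskian of the conditions `c_i`, multiplied by the exponential factor of the gauge. -/
noncomputable def gaugedTau {N : ℕ} (c : Fin N → Condition) (α β x t : ℂ) : ℂ :=
  Complex.exp (-(x * α + t * β)) * wronskian c Fin.val x t

/-- The bordered Wronskian, multiplied by the exponential factor of the gauge and stripped of the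
factor `exp (x z)`. Up to the factor `q(z)`, it is the product of the tau function and the
normalized wave function. -/
noncomputable def gaugedWave {N : ℕ} (c : Fin N → Condition) (α z x : ℂ) : ℂ :=
  Complex.exp (-(x * (α + z))) * wronskian (border c z) Fin.val x 0

theorem hasDerivAt_cexp_neg_mul (α β x : ℂ) :
    HasDerivAt (fun x : ℂ => Complex.exp (-(x * α + β))) (-α * Complex.exp (-(x * α + β))) x := by
  have h := (((hasDerivAt_id x).mul_const α).add_const β).neg.cexp
  simpa [mul_comm] using! h

/-- A strictly differentiable function of two variables has its partial derivatives as
differential. -/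
theorem hasStrictFDerivAt_partials {F : ℂ × ℂ → ℂ} {F' : ℂ × ℂ →L[ℂ] ℂ} {p : ℂ × ℂ}
    (h : HasStrictFDerivAt F F' p) :
    HasStrictFDerivAt F
      (partials (deriv (fun x => F (x, p.2)) p.1) (deriv (fun t => F (p.1, t)) p.2)) p := by
  have h1 := h.hasFDerivAt.comp_hasDerivAt p.1
    ((hasDerivAt_id p.1).prodMk (hasDerivAt_const p.1 p.2))
  have h2 := h.hasFDerivAt.comp_hasDerivAt p.2
    ((hasDerivAt_const p.2 p.1).prodMk (hasDerivAt_id p.2))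
  have e1 : deriv (fun x => F (x, p.2)) p.1 = F' (1, 0) := h1.deriv
  have e2 : deriv (fun t => F (p.1, t)) p.2 = F' (0, 1) := h2.deriv
  refine h.congr_fderiv ?_
  rw [e1, e2]
  ext <;> simp

theorem hasStrictFDerivAt_gaugedTau {N : ℕ} (c : Fin N → Condition) (α β : ℂ) (p : ℂ × ℂ) :
    HasStrictFDerivAt (fun p : ℂ × ℂ => gaugedTau c α β p.1 p.2)
      (partials (deriv (fun x => gaugedTau c α β x p.2) p.1)
        (deriv (fun t => gaugedTau c α β p.1 t) p.2)) p :=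
  hasStrictFDerivAt_partials
    ((((hasStrictFDerivAt_fst (𝕜 := ℂ) (p := p)).mul_const α).add
        ((hasStrictFDerivAt_snd (𝕜 := ℂ) (p := p)).mul_const β)).neg.cexp.mul
      (hasStrictFDerivAt_wronskian c Fin.val p))

theorem differentiable_gaugedTau {N : ℕ} (c : Fin N → Condition) (α β t : ℂ) :
    Differentiable ℂ fun x => gaugedTau c α β x t := fun x =>
  ((hasDerivAt_cexp_neg_mul α (t * β) x).mul (hasDerivAt_wronskian c _ x t)).differentiableAt

theorem differentiable_gaugedWave {N : ℕ} (c : Fin N → Condition) (α z : ℂ) :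
    Differentiable ℂ (gaugedWave c α z) := fun x => by
  have h := (hasDerivAt_cexp_neg_mul (α + z) 0 x).mul (hasDerivAt_wronskian (border c z) Fin.val x 0)
  simp only [add_zero] at h
  exact h.differentiableAt

/-- Hirota's bilinear form of the Lax equation `ψ_t = ψ_xx + 2 (log τ)_xx ψ`, at a simple zero of
the tau function and at time `t = 0`. -/
theorem gaugedWave_bilinear {N : ℕ} (c : Fin N → Condition) (α β x z : ℂ)
    (h0 : gaugedTau c α β x 0 = 0) (h1 : deriv (fun x => gaugedTau c α β x 0) x ≠ 0) :
    gaugedWave c α z x * (deriv (fun t => gaugedTau c α β x t) 0 +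
        deriv (deriv fun x => gaugedTau c α β x 0) x) =
      2 * deriv (fun x => gaugedTau c α β x 0) x *
        (deriv (gaugedWave c α z) x + z * gaugedWave c α z x) := by
  rcases N with _ | m
  · simp [gaugedTau, wronskian] at h0
  have e0 : wronskian c Fin.val x 0 = 0 := by
    simpa [gaugedTau] using h0
  have hx (x : ℂ) : HasDerivAt (fun x => gaugedTau c α β x 0)
      (Complex.exp (-(x * α + 0 * β)) *
        (wronskian c (replaceLast m (m + 1)) x 0 - α * wronskian c Fin.val x 0)) x :=
    ((hasDerivAt_cexp_neg_mul α (0 * β) x).mul (hasDerivAt_wronskian_val c x 0)).congr_deriv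
      (by ring)
  have hd : (deriv fun x => gaugedTau c α β x 0) = fun x => Complex.exp (-(x * α + 0 * β)) *
      (wronskian c (replaceLast m (m + 1)) x 0 - α * wronskian c Fin.val x 0) :=
    funext fun x => (hx x).deriv
  have hxx := (hasDerivAt_cexp_neg_mul α (0 * β) x).mul
    ((hasDerivAt_wronskian c (replaceLast m (m + 1)) x 0).sub
      ((hasDerivAt_wronskian_val c x 0).const_mul α))
  have ht : HasDerivAt (fun t => gaugedTau c α β x t) _ 0 :=
    HasDerivAt.mul (c := fun t => Complex.exp (-(x * α + t * β)))
      (by simpa [add_comm, mul_comm] using! hasDerivAt_cexp_neg_mul β (x * α) 0)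
      (hasDerivAt_wronskian_time c Fin.val x 0)
  have hw : deriv (gaugedWave c α z) x =
      -(α + z) * Complex.exp (-(x * (α + z))) * wronskian (border c z) Fin.val x 0 +
        Complex.exp (-(x * (α + z))) *
          wronskian (border c z) (replaceLast (m + 1) (m + 2)) x 0 := by
    have h := (hasDerivAt_cexp_neg_mul (α + z) 0 x).mul (hasDerivAt_wronskian_val (border c z) x 0)
    simp only [add_zero] at h
    exact h.deriv
  rw [hd] at h1 ⊢
  have e1 : wronskian c (replaceLast m (m + 1)) x 0 ≠ 0 := by
    intro h
    simp [h, e0] at h1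
  have hP := wronskian_border_mul_wronskian c x 0 z e0 e1
  have hS := sum_wronskian_update c x 0
  have hxx' : deriv (fun x => Complex.exp (-(x * α + 0 * β)) *
      (wronskian c (replaceLast m (m + 1)) x 0 - α * wronskian c Fin.val x 0)) x = _ := hxx.deriv
  rw [ht.deriv, hxx', hw]
  simp only [gaugedWave, e0, Pi.sub_apply]
  have hE : Complex.exp (-(x * α + 0 * β)) ≠ 0 := Complex.exp_ne_zero _
  simp only [zero_mul, add_zero, mul_zero, sub_zero] at hS hP ⊢
  generalize Complex.exp (-(x * α)) = E at *
  generalize Complex.exp (-(x * (α + z))) = E' at *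
  linear_combination (E' * E * wronskian (border c z) Fin.val x 0) * hS + 2 * E * E' * hP

/-! ### Partial fractions with simple poles -/

section PartialFractions

variable {ι : Type*} [Fintype ι] [DecidableEq ι]

/-- The polynomial function `∏ j, (z - x j)`. -/
def nodal (x : ι → ℂ) (z : ℂ) : ℂ := ∏ j, (z - x j)

/-- The polynomial function `∏ j ≠ i, (z - x j)`. -/
def nodalErase (x : ι → ℂ) (i : ι) (z : ℂ) : ℂ := ∏ j ∈ Finset.univ.erase i, (z - x j)

/-- The numerator of `1 + ∑ i, a i / (z - x i)` over the denominator `∏ j, (z - x j)`. -/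
def numerator (x a : ι → ℂ) (z : ℂ) : ℂ := nodal x z + ∑ i, a i * nodalErase x i z

theorem nodal_eq_mul (x : ι → ℂ) (i : ι) (z : ℂ) : nodal x z = (z - x i) * nodalErase x i z :=
  (Finset.mul_prod_erase _ _ (Finset.mem_univ i)).symm

omit [DecidableEq ι] in
theorem nodal_ne_zero_iff (x : ι → ℂ) (z : ℂ) : nodal x z ≠ 0 ↔ ∀ i, z ≠ x i := by
  simp [nodal, Finset.prod_ne_zero_iff, sub_ne_zero]

theorem nodal_apply_node (x : ι → ℂ) (i : ι) : nodal x (x i) = 0 := by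
  rw [nodal_eq_mul x i, sub_self, zero_mul]

theorem nodalErase_ne_zero {x : ι → ℂ} (hx : Function.Injective x) (i : ι) :
    nodalErase x i (x i) ≠ 0 := by
  rw [nodalErase, Finset.prod_ne_zero_iff]
  exact fun j hj => sub_ne_zero.mpr fun h => Finset.ne_of_mem_erase hj (hx h.symm)

theorem nodalErase_apply_of_ne (x : ι → ℂ) {i j : ι} (h : i ≠ j) : nodalErase x i (x j) = 0 :=
  Finset.prod_eq_zero (Finset.mem_erase.mpr ⟨h.symm, Finset.mem_univ j⟩) (sub_self _)

omit [DecidableEq ι] in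
theorem differentiable_nodal (x : ι → ℂ) : Differentiable ℂ (nodal x) := by
  unfold nodal; fun_prop

theorem differentiable_nodalErase (x : ι → ℂ) (i : ι) : Differentiable ℂ (nodalErase x i) := by
  unfold nodalErase; fun_prop

theorem differentiable_numerator (x a : ι → ℂ) : Differentiable ℂ (numerator x a) := by
  have := differentiable_nodal x
  have := differentiable_nodalErase x
  unfold numerator; fun_prop

theorem numerator_eq_mul (x a : ι → ℂ) {z : ℂ} (hz : ∀ i, z ≠ x i) :
    numerator x a z = nodal x z * (1 + ∑ i, a i / (z - x i)) := by
  rw [numerator, mul_add, mul_one, Finset.mul_sum]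
  congr 1
  refine Finset.sum_congr rfl fun i _ => ?_
  have := sub_ne_zero.mpr (hz i)
  rw [nodal_eq_mul x i]
  field_simp

theorem numerator_apply_node (x a : ι → ℂ) (i : ι) :
    numerator x a (x i) = a i * nodalErase x i (x i) := by
  rw [numerator, nodal_apply_node, zero_add, Fintype.sum_eq_single i]
  intro j hj
  rw [nodalErase_apply_of_ne x hj, mul_zero]

theorem hasDerivAt_sub_mul {g : ℂ → ℂ} {w : ℂ} (hg : DifferentiableAt ℂ g w) :
    HasDerivAt (fun z => (z - w) * g z) (g w) w := by
  have h := ((hasDerivAt_id w).sub_const w).mul hg.hasDerivAt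
  simpa using! h

theorem deriv_nodal_node (x : ι → ℂ) (i : ι) : deriv (nodal x) (x i) = nodalErase x i (x i) := by
  rw [funext (nodal_eq_mul x i)]
  exact (hasDerivAt_sub_mul (differentiable_nodalErase x i _)).deriv

theorem deriv_nodalErase_self {x : ι → ℂ} (hx : Function.Injective x) (i : ι) :
    deriv (nodalErase x i) (x i) =
      nodalErase x i (x i) * ∑ j ∈ Finset.univ.erase i, 1 / (x i - x j) := by
  have h := HasDerivAt.fun_finsetProd (u := Finset.univ.erase i) (f := fun j z => z - x j)
    (f' := fun _ => 1) (x := x i) fun j _ => (hasDerivAt_id (x i)).sub_const (x j)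
  refine h.deriv.trans ?_
  rw [Finset.mul_sum]
  refine Finset.sum_congr rfl fun j hj => ?_
  have hne : x i - x j ≠ 0 := sub_ne_zero.mpr fun h => Finset.ne_of_mem_erase hj (hx h.symm)
  rw [nodalErase, ← Finset.mul_prod_erase _ _ hj]
  simp only [smul_eq_mul]
  field_simp

theorem deriv_nodalErase_of_ne {x : ι → ℂ} (hx : Function.Injective x) {i j : ι} (hij : i ≠ j) :
    deriv (nodalErase x i) (x j) = nodalErase x j (x j) / (x j - x i) := by
  have hj : j ∈ Finset.univ.erase i := Finset.mem_erase.mpr ⟨hij.symm, Finset.mem_univ j⟩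
  have hi : i ∈ Finset.univ.erase j := Finset.mem_erase.mpr ⟨hij, Finset.mem_univ i⟩
  have e : nodalErase x i = fun z => (z - x j) * ∏ k ∈ (Finset.univ.erase i).erase j, (z - x k) :=
    funext fun z => (Finset.mul_prod_erase _ _ hj).symm
  have hne : x j - x i ≠ 0 := sub_ne_zero.mpr fun h => hij (hx h.symm)
  rw [e, (hasDerivAt_sub_mul (by fun_prop)).deriv, nodalErase, ← Finset.mul_prod_erase _ _ hi,
    Finset.erase_right_comm]
  field_simp

/-- At a simple zero the second derivative of `(z - x i) g(z)` is `2 g'(x i)`. -/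
theorem deriv_deriv_nodal_node {x : ι → ℂ} (hx : Function.Injective x) (i : ι) :
    deriv (deriv (nodal x)) (x i) =
      2 * (nodalErase x i (x i) * ∑ j ∈ Finset.univ.erase i, 1 / (x i - x j)) := by
  have hd := differentiable_nodalErase x i
  have e : deriv (nodal x) = fun z => nodalErase x i z + (z - x i) * deriv (nodalErase x i) z := by
    funext z
    rw [funext (nodal_eq_mul x i)]
    have h := ((hasDerivAt_id z).sub_const (x i)).mul (hd z).hasDerivAt
    refine h.deriv.trans ?_
    simp
  rw [e, two_mul, ← deriv_nodalErase_self hx]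
  exact ((hd _).hasDerivAt.add
    (hasDerivAt_sub_mul ((hd.analyticAt _).deriv.differentiableAt))).deriv

theorem deriv_numerator_node {x : ι → ℂ} (hx : Function.Injective x) (a : ι → ℂ) (i : ι) :
    deriv (numerator x a) (x i) = nodalErase x i (x i) *
      (1 + ∑ j ∈ Finset.univ.erase i, a j / (x i - x j) +
        a i * ∑ j ∈ Finset.univ.erase i, 1 / (x i - x j)) := by
  have h := (differentiable_nodal x (x i)).hasDerivAt.add
    (HasDerivAt.fun_sum (u := Finset.univ) fun j _ =>
      ((differentiable_nodalErase x j (x i)).hasDerivAt.const_mul (a j)))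
  refine h.deriv.trans ?_
  rw [deriv_nodal_node, ← Finset.add_sum_erase _ _ (Finset.mem_univ i), deriv_nodalErase_self hx,
    mul_add, mul_add, mul_one, Finset.mul_sum (f := fun j => a j / (x i - x j)), add_assoc]
  congr 1
  rw [add_comm]
  congr 1
  · refine Finset.sum_congr rfl fun j hj => ?_
    rw [deriv_nodalErase_of_ne hx (Finset.ne_of_mem_erase hj)]
    ring
  · ring

/-! ### The linear system of the Calogero-Moser matrix -/

/-- The linear system `(z + Y) a = -(1, …, 1)`, where `Y` is the Calogero-Moser matrix with
diagonal entries `y i` and off-diagonal entries `1 / (x i - x j)`. -/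
def CMSystem (x y : ι → ℂ) (z : ℂ) (a : ι → ℂ) : Prop :=
  ∀ i, (z + y i) * a i + ∑ j ∈ Finset.univ.erase i, a j / (x i - x j) = -1

/-- A bound for the row sums of the Calogero-Moser matrix. -/
noncomputable def cmBound (x y : ι → ℂ) : ℝ :=
  ‖y‖ + ∑ i, ∑ j, ‖1 / (x i - x j)‖

omit [DecidableEq ι] in
theorem cmBound_nonneg (x y : ι → ℂ) : 0 ≤ cmBound x y := by
  unfold cmBound; positivity

theorem norm_row_le (x y a : ι → ℂ) (i : ι) :
    ‖y i * a i + ∑ j ∈ Finset.univ.erase i, a j / (x i - x j)‖ ≤ cmBound x y * ‖a‖ := by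
  have h1 : ‖∑ j ∈ Finset.univ.erase i, a j / (x i - x j)‖ ≤
      ∑ j, ‖1 / (x i - x j)‖ * ‖a‖ := by
    refine (norm_sum_le _ _).trans ((Finset.sum_le_sum fun j _ => ?_).trans
      (Finset.sum_le_univ_sum_of_nonneg fun j => by positivity))
    rw [div_eq_mul_one_div, norm_mul, mul_comm]
    exact mul_le_mul_of_nonneg_left (norm_le_pi_norm a j) (norm_nonneg _)
  have h2 : ∑ j, ‖1 / (x i - x j)‖ ≤ ∑ i, ∑ j, ‖1 / (x i - x j)‖ :=
    Finset.single_le_sum (f := fun i => ∑ j, ‖1 / (x i - x j)‖) (fun i _ => by positivity)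
      (Finset.mem_univ i)
  rw [← Finset.sum_mul] at h1
  calc _ ≤ ‖y i‖ * ‖a i‖ + (∑ j, ‖1 / (x i - x j)‖) * ‖a‖ :=
        (norm_add_le _ _).trans (add_le_add (norm_mul _ _).le h1)
    _ ≤ ‖y‖ * ‖a‖ + (∑ i, ∑ j, ‖1 / (x i - x j)‖) * ‖a‖ := by
        gcongr
        · exact norm_le_pi_norm y i
        · exact norm_le_pi_norm a i
    _ = _ := by rw [cmBound, add_mul]

theorem CMSystem.norm_one_add_le {x y a : ι → ℂ} {z : ℂ} (h : CMSystem x y z a) (i : ι) :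
    ‖1 + z * a i‖ ≤ cmBound x y * ‖a‖ := by
  have e : 1 + z * a i = -(y i * a i + ∑ j ∈ Finset.univ.erase i, a j / (x i - x j)) := by
    linear_combination h i
  rw [e, norm_neg]
  exact norm_row_le x y a i

/-- An a priori bound: a solution is `O(1 / z)` as `z → ∞`. -/
theorem CMSystem.mul_norm_le {x y a : ι → ℂ} {z : ℂ} (h : CMSystem x y z a) :
    ‖z‖ * ‖a‖ ≤ 1 + cmBound x y * ‖a‖ := by
  have hK := cmBound_nonneg x y
  rw [← norm_smul, pi_norm_le_iff_of_nonneg (by positivity)]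
  intro i
  have e : (z • a) i = (1 + z * a i) - 1 := by simp
  rw [e]
  refine (norm_sub_le _ _).trans ?_
  rw [norm_one, add_comm]
  gcongr
  exact h.norm_one_add_le i

/-- For large `z` the solution is close to `-1 / z`. -/
theorem CMSystem.ne_zero {x y a : ι → ℂ} {z : ℂ} (h : CMSystem x y z a)
    (hz : 2 * cmBound x y < ‖z‖) (i : ι) : a i ≠ 0 := by
  intro hi
  have h1 := h.norm_one_add_le i
  have h2 := h.mul_norm_le
  rw [hi, mul_zero, add_zero, norm_one] at h1
  have h3 : 0 < ‖a‖ := by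
    by_contra h0
    have : ‖a‖ = 0 := le_antisymm (not_lt.mp h0) (norm_nonneg a)
    rw [this] at h1
    linarith
  nlinarith

/-- The Calogero-Moser matrix. -/
noncomputable def cmMatrix (x y : ι → ℂ) : Matrix ι ι ℂ :=
  Matrix.of fun i j => if i = j then y i else 1 / (x i - x j)

/-- Off the finitely many eigenvalues of minus the Calogero-Moser matrix, the linear system has at
most one solution. -/
theorem eventually_cmSystem_unique (x y : ι → ℂ) :
    ∀ᶠ z in Filter.cofinite, ∀ a b, CMSystem x y z a → CMSystem x y z b → a = b := by
  have hfin : {z | (-cmMatrix x y).charpoly.eval z = 0}.Finite :=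
    Polynomial.finite_setOfPred_isRoot (Matrix.charpoly_monic _).ne_zero
  filter_upwards [hfin.compl_mem_cofinite] with z hz a b ha hb
  by_contra hab
  refine hz ?_
  rw [Set.mem_ofPred_eq, Matrix.eval_charpoly, ← Matrix.exists_mulVec_eq_zero_iff]
  refine ⟨a - b, sub_ne_zero.mpr hab, ?_⟩
  funext i
  have e : ∑ j ∈ Finset.univ.erase i, cmMatrix x y i j * (a - b) j =
      ∑ j ∈ Finset.univ.erase i, a j / (x i - x j) -
        ∑ j ∈ Finset.univ.erase i, b j / (x i - x j) := by
    rw [← Finset.sum_sub_distrib]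
    refine Finset.sum_congr rfl fun j hj => ?_
    rw [cmMatrix, Matrix.of_apply, if_neg (Finset.ne_of_mem_erase hj).symm, Pi.sub_apply]
    ring
  have e' : (cmMatrix x y).mulVec (a - b) i = y i * (a i - b i) +
      (∑ j ∈ Finset.univ.erase i, a j / (x i - x j) -
        ∑ j ∈ Finset.univ.erase i, b j / (x i - x j)) := by
    rw [← e, Matrix.mulVec, dotProduct, ← Finset.add_sum_erase _ _ (Finset.mem_univ i)]
    simp [cmMatrix]
  rw [sub_neg_eq_add, Matrix.add_mulVec, Pi.add_apply, e', Matrix.scalar_apply,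
    Matrix.mulVec_diagonal, Pi.sub_apply, Pi.zero_apply]
  linear_combination ha i - hb i

end PartialFractions

/-! ### Entire functions of polynomial growth -/

open Filter Bornology

theorem tendsto_sub_inv_cobounded (w : ℂ) :
    Tendsto (fun z : ℂ => (z - w)⁻¹) (cobounded ℂ) (𝓝 0) := by
  have h : Tendsto (fun z : ℂ => z - w) (cobounded ℂ) (cobounded ℂ) := by
    simp [sub_eq_add_neg]
  exact tendsto_inv₀_cobounded.comp h

theorem tendsto_eval_div_pow {p : ℂ[X]} {M : ℕ} (hp : p.degree < M) :
    Tendsto (fun z => p.eval z / z ^ M) (cobounded ℂ) (𝓝 0) := by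
  rcases eq_or_ne p 0 with rfl | hp0
  · simp
  have hd : p.natDegree < M := (Polynomial.natDegree_lt_iff_degree_lt hp0).mpr hp
  have h (i : ℕ) (hi : i ∈ Finset.range (p.natDegree + 1)) :
      Tendsto (fun z : ℂ => p.coeff i * z⁻¹ ^ (M - i)) (cobounded ℂ) (𝓝 0) := by
    have h1 := ((tendsto_inv₀_cobounded (α := ℂ)).pow (M - i)).const_mul (p.coeff i)
    rwa [zero_pow (by simp at hi; omega), mul_zero] at h1
  have hs := tendsto_finsetSum _ h
  rw [Finset.sum_const_zero] at hs
  refine hs.congr' ?_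
  filter_upwards [(Bornology.le_cofinite ℂ) (Set.finite_singleton (0 : ℂ)).compl_mem_cofinite]
    with z hz
  rw [Polynomial.eval_eq_sum_range, Finset.sum_div]
  refine Finset.sum_congr rfl fun i hi => ?_
  have hz' : z ≠ 0 := hz
  have hi' : i ≤ M := by simp at hi; omega
  rw [inv_pow, pow_sub₀ _ hz' hi']
  field_simp

theorem tendsto_monic_eval_div_pow {q : ℂ[X]} (hq : q.Monic) :
    Tendsto (fun z => q.eval z / z ^ q.natDegree) (cobounded ℂ) (𝓝 1) := by
  have hd : (q - Polynomial.X ^ q.natDegree).degree < (q.natDegree : WithBot ℕ) := by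
    refine (Polynomial.degree_sub_lt_left ?_ hq.ne_zero ?_).trans_eq
      (Polynomial.degree_eq_natDegree hq.ne_zero)
    · rw [Polynomial.degree_X_pow, Polynomial.degree_eq_natDegree hq.ne_zero]
    · rw [hq.leadingCoeff, Polynomial.leadingCoeff_X_pow]
  have h := (tendsto_eval_div_pow hd).const_add 1
  rw [add_zero] at h
  refine h.congr' ?_
  filter_upwards [(Bornology.le_cofinite ℂ) (Set.finite_singleton (0 : ℂ)).compl_mem_cofinite]
    with z hz
  have hz' : z ^ q.natDegree ≠ 0 := pow_ne_zero _ hz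
  simp only [Polynomial.eval_sub, Polynomial.eval_pow, Polynomial.eval_X]
  field_simp
  ring

/-- Liouville's theorem for polynomial growth, by repeated division by `z`. -/
theorem exists_polynomial_of_tendsto_div_pow {F : ℂ → ℂ} (hF : Differentiable ℂ F) {M : ℕ}
    (h : Tendsto (fun z => F z / z ^ M) (cobounded ℂ) (𝓝 0)) :
    ∃ p : ℂ[X], p.degree < M ∧ ∀ z, F z = p.eval z := by
  induction M generalizing F with
  | zero =>
    refine ⟨0, by simp, fun z => ?_⟩
    simp only [pow_zero, div_one, Metric.cobounded_eq_cocompact] at h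
    rw [hF.apply_eq_of_tendsto_cocompact z h, Polynomial.eval_zero]
  | succ M ih =>
    have hG : Differentiable ℂ (dslope F 0) := by
      rw [← differentiableOn_univ, Complex.differentiableOn_dslope univ_mem]
      exact hF.differentiableOn
    have hC : Tendsto (fun z : ℂ => F 0 / z ^ (M + 1)) (cobounded ℂ) (𝓝 0) := by
      have := tendsto_eval_div_pow (p := Polynomial.C (F 0)) (M := M + 1)
        (Polynomial.degree_C_le.trans_lt (by exact_mod_cast Nat.succ_pos M))
      simpa using this
    have hlim : Tendsto (fun z => dslope F 0 z / z ^ M) (cobounded ℂ) (𝓝 0) := by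
      have h' := h.sub hC
      rw [sub_zero] at h'
      refine h'.congr' ?_
      filter_upwards [(Bornology.le_cofinite ℂ) (Set.finite_singleton (0 : ℂ)).compl_mem_cofinite]
        with z hz
      have hz' : z ≠ 0 := hz
      rw [dslope_of_ne _ hz', slope_def_field]
      field_simp
      ring
    obtain ⟨p, hp, hFp⟩ := ih hG hlim
    refine ⟨p * Polynomial.X + Polynomial.C (F 0), ?_, fun z => ?_⟩
    · refine (Polynomial.degree_add_le _ _).trans_lt (max_lt ?_ ?_)
      · rw [Polynomial.degree_mul, Polynomial.degree_X]
        rcases eq_or_ne p 0 with rfl | hp0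
        · simp
        · rw [Polynomial.degree_eq_natDegree hp0] at hp ⊢
          exact_mod_cast Nat.succ_lt_succ (by exact_mod_cast hp)
      · exact Polynomial.degree_C_le.trans_lt (by exact_mod_cast Nat.succ_pos M)
    · have := sub_smul_dslope F 0 z
      rw [sub_zero, smul_eq_mul, hFp z] at this
      simp only [Polynomial.eval_add, Polynomial.eval_mul, Polynomial.eval_X, Polynomial.eval_C]
      linear_combination -this

theorem tendsto_mul_ratio {F P Q : ℂ → ℂ} {a : ℂ} (h1 : Tendsto (fun z => F z / P z) (cobounded ℂ) (𝓝 a))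
    (h2 : Tendsto (fun z => P z / Q z) (cobounded ℂ) (𝓝 1)) :
    Tendsto (fun z => F z / Q z) (cobounded ℂ) (𝓝 a) := by
  have h := h1.mul h2
  rw [mul_one] at h
  refine h.congr' ?_
  filter_upwards [h2.eventually_ne one_ne_zero] with z hz
  have hP : P z ≠ 0 := fun h => hz (by rw [h, zero_div])
  rw [div_mul_div_cancel₀ hP]

theorem exists_polynomial_of_tendsto_div_eval {F : ℂ → ℂ} (hF : Differentiable ℂ F) {q : ℂ[X]}
    (hq : q.Monic) (h : Tendsto (fun z => F z / q.eval z) (cobounded ℂ) (𝓝 1)) :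
    ∃ p : ℂ[X], p.degree < q.natDegree ∧ ∀ z, F z = z ^ q.natDegree + p.eval z := by
  have h1 := tendsto_mul_ratio h (tendsto_monic_eval_div_pow hq)
  have h2 := h1.sub (tendsto_monic_eval_div_pow (Polynomial.monic_X_pow q.natDegree))
  simp only [Polynomial.natDegree_X_pow, Polynomial.eval_pow, Polynomial.eval_X, ← sub_div,
    sub_self] at h2
  obtain ⟨p, hp, hFp⟩ := exists_polynomial_of_tendsto_div_pow
    (F := fun z => F z - z ^ q.natDegree) (by fun_prop) h2
  exact ⟨p, hp, fun z => by rw [← hFp]; ring⟩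

section

variable {ι : Type*} [Fintype ι] [DecidableEq ι]

omit [DecidableEq ι] in
theorem nodal_eq_eval (x : ι → ℂ) (z : ℂ) :
    nodal x z = (∏ i, (Polynomial.X - Polynomial.C (x i))).eval z := by
  simp [nodal, Polynomial.eval_prod]

omit [DecidableEq ι] in
theorem eventually_ne_cobounded (x : ι → ℂ) : ∀ᶠ z in cobounded ℂ, ∀ i, z ≠ x i := by
  filter_upwards [(Bornology.le_cofinite ℂ) (Set.finite_range x).compl_mem_cofinite] with z hz i hi
  exact hz ⟨i, hi.symm⟩

theorem tendsto_numerator_div_nodal (x a : ι → ℂ) :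
    Tendsto (fun z => numerator x a z / nodal x z) (cobounded ℂ) (𝓝 1) := by
  have h := (tendsto_finsetSum Finset.univ fun i _ =>
    (tendsto_sub_inv_cobounded (x i)).const_mul (a i)).const_add 1
  simp only [mul_zero, Finset.sum_const_zero, add_zero, ← div_eq_mul_inv] at h
  refine h.congr' ?_
  filter_upwards [eventually_ne_cobounded x] with z hz
  rw [numerator_eq_mul x a hz, mul_div_cancel_left₀]
  exact (nodal_ne_zero_iff x z).mpr hz

/-- Partial fractions for an entire function that grows like `∏ i, (z - x i)`. -/
theorem exists_eq_numerator {x : ι → ℂ} (hx : Function.Injective x) {F : ℂ → ℂ}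
    (hF : Differentiable ℂ F)
    (h : Tendsto (fun z => F z / nodal x z) (cobounded ℂ) (𝓝 1)) :
    ∃ a, F = numerator x a := by
  set a : ι → ℂ := fun i => F (x i) / nodalErase x i (x i)
  refine ⟨a, ?_⟩
  have hd := differentiable_numerator x a
  set q : ℂ[X] := ∏ i, (Polynomial.X - Polynomial.C (x i))
  have hq : q.Monic := Polynomial.monic_prod_of_monic _ _ fun i _ => Polynomial.monic_X_sub_C _
  have hdeg : q.natDegree = Fintype.card ι := by simp [q]
  have h1 := h.sub (tendsto_numerator_div_nodal x a)
  simp only [← sub_div, sub_self, nodal_eq_eval] at h1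
  obtain ⟨p, hp, hFp⟩ := exists_polynomial_of_tendsto_div_pow
    (F := fun z => F z - numerator x a z) (by fun_prop)
    (tendsto_mul_ratio h1 (tendsto_monic_eval_div_pow hq))
  have hp0 : p = 0 := by
    by_contra hne
    refine hne (Polynomial.eq_zero_of_natDegree_lt_card_of_eval_eq_zero p hx (fun i => ?_) ?_)
    · rw [← hFp, numerator_apply_node, div_mul_cancel₀ _ (nodalErase_ne_zero hx i), sub_self]
    · rw [← hdeg]
      exact (Polynomial.natDegree_lt_iff_degree_lt hne).mpr hp
  funext z
  have := hFp z
  rw [hp0, Polynomial.eval_zero] at this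
  exact sub_eq_zero.mp this

end

theorem Condition.apply_sum_powExp (c : Condition) {N : ℕ} (s : Fin N → ℂ) (x t : ℂ) :
    c.apply (fun z => ∑ j, s j * powExp j x t z) = ∑ j, s j * c.apply (powExp j x t) :=
  c.apply_sum_mul Finset.univ s (fun j : Fin N => powExp (j : ℕ) x t)
    fun j _ => contDiff_powExp (j : ℕ) x t

/-! ### Wave functions -/

namespace DualPoint

variable (W : DualPoint)

/-- A basis of the space of conditions. -/
noncomputable def cond : Fin (Module.finrank ℂ W.C) → Condition :=
  haveI := W.finiteDimensional
  fun i => Module.finBasis ℂ W.C i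

/-- The sum of the zeros of `q`. -/
noncomputable def rootSum : ℂ := W.q.roots.sum

/-- The sum of the squares of the zeros of `q`. -/
noncomputable def rootSqSum : ℂ := (W.q.roots.map (· ^ 2)).sum

theorem tau_eq_gaugedTau (x t : ℂ) :
    W.tau x t = gaugedTau W.cond W.rootSum W.rootSqSum x t := by
  have h : (W.q.roots.map fun r => x * r + t * r ^ 2).sum = x * W.rootSum + t * W.rootSqSum := by
    rw [Multiset.sum_map_add, Multiset.sum_map_mul_left, Multiset.sum_map_mul_left, Multiset.map_id',
      rootSum, rootSqSum]
  rw [tau, h]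
  rfl

theorem differentiable_tau (t : ℂ) : Differentiable ℂ fun x => W.tau x t := by
  simp only [tau_eq_gaugedTau]
  exact differentiable_gaugedTau _ _ _ t

theorem hasStrictFDerivAt_tau (p : ℂ × ℂ) :
    HasStrictFDerivAt (fun p : ℂ × ℂ => W.tau p.1 p.2)
      (partials (deriv (fun x => W.tau x p.2) p.1) (deriv (fun t => W.tau p.1 t) p.2)) p := by
  simp only [tau_eq_gaugedTau]
  exact hasStrictFDerivAt_gaugedTau _ _ _ p

theorem apply_eq_zero_of_cond {F : ℂ → ℂ} (h : ∀ i, (W.cond i).apply F = 0) :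
    ∀ c ∈ W.C, Condition.apply c F = 0 := by
  have := W.finiteDimensional
  intro c hc
  have h0 : (Condition.eval F).comp W.C.subtype = 0 :=
    (Module.finBasis ℂ W.C).ext fun i => h i
  exact LinearMap.congr_fun h0 ⟨c, hc⟩

theorem cond_mem (i : Fin (Module.finrank ℂ W.C)) : W.cond i ∈ W.C := Subtype.prop _

variable {W}

theorem tendsto_cexp_mul_iff {f F : ℂ → ℂ} {x : ℂ}
    (hfF : ∀ z, W.q.eval z ≠ 0 → f z = F z / W.q.eval z) {a : ℂ} :
    Tendsto (fun z => f z * Complex.exp (-(x * z))) (cobounded ℂ) (𝓝 a) ↔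
      Tendsto (fun z => F z * Complex.exp (-(x * z)) / W.q.eval z) (cobounded ℂ) (𝓝 a) := by
  refine tendsto_congr' ?_
  filter_upwards [(Bornology.le_cofinite ℂ)
    (Polynomial.finite_setOfPred_isRoot W.monic.ne_zero).compl_mem_cofinite] with z hz
  rw [hfF z hz]
  ring

/-- An element of `W` of the form `(1 + O(z⁻¹)) exp (x z)` is `exp (x z)` times a monic polynomial
of degree `dim C`, divided by `q`. -/
theorem Mem.exists_eq_sum {f : ℂ → ℂ} {x : ℂ} (hf : W.Mem f)
    (hlim : Tendsto (fun z => f z * Complex.exp (-(x * z))) (cobounded ℂ) (𝓝 1)) :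
    ∃ s : Fin (Module.finrank ℂ W.C + 1) → ℂ, s (Fin.last _) = 1 ∧
      (∀ i, ∑ j, s j * (W.cond i).apply (powExp j x 0) = 0) ∧
      ∀ z, W.q.eval z ≠ 0 → f z * W.q.eval z = ∑ j, s j * powExp j x 0 z := by
  obtain ⟨F, hF, hC, hfF⟩ := hf
  rw [tendsto_cexp_mul_iff hfF] at hlim
  obtain ⟨p, hp, hFp⟩ := exists_polynomial_of_tendsto_div_eval (by fun_prop) W.monic hlim
  rw [W.natDegree_eq] at hp hFp
  set s : Fin (Module.finrank ℂ W.C + 1) → ℂ :=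
    Fin.snoc (α := fun _ => ℂ) (fun j => p.coeff j) 1 with hs
  have hFs : F = fun z => ∑ j, s j * powExp j x 0 z := by
    funext z
    have h1 : F z = (F z * Complex.exp (-(x * z))) * Complex.exp (x * z) := by
      rw [mul_assoc, ← Complex.exp_add, neg_add_cancel, Complex.exp_zero, mul_one]
    have h2 : p.eval z = ∑ j : Fin (Module.finrank ℂ W.C), p.coeff j * z ^ (j : ℕ) := by
      rcases eq_or_ne p 0 with rfl | hp0
      · simp
      · rw [Polynomial.eval_eq_sum_range'
          ((Polynomial.natDegree_lt_iff_degree_lt hp0).mpr hp), Finset.sum_range]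
    rw [h1, hFp, h2, Fin.sum_univ_castSucc, add_mul, Finset.sum_mul, add_comm]
    simp [hs, powExp, mul_assoc]
  refine ⟨s, by simp [hs], fun i => ?_, fun z hz => ?_⟩
  · rw [← Condition.apply_sum_powExp, ← hFs, hC _ (W.cond_mem i)]
  · rw [hfF z hz, div_mul_cancel₀ _ hz, hFs]

/-- The wave function is the quotient of the bordered Wronskian and the Wronskian. -/
theorem Mem.mul_tau_eq_gaugedWave {f : ℂ → ℂ} {x : ℂ} (hf : W.Mem f)
    (hlim : Tendsto (fun z => f z * Complex.exp (-(x * z))) (cobounded ℂ) (𝓝 1))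
    {z : ℂ} (hz : W.q.eval z ≠ 0) :
    f z * Complex.exp (-(x * z)) * W.q.eval z * W.tau x 0 = gaugedWave W.cond W.rootSum z x := by
  obtain ⟨s, hs1, hs0, hs⟩ := hf.exists_eq_sum hlim
  have h := wronskian_border_mul W.cond Fin.val x 0 z s hs0 (Fin.last _)
  rw [hs1, mul_one, Fin.val_last, ← two_mul, pow_mul, neg_one_sq, one_pow, one_mul, ← hs z hz] at h
  have e : (Fin.val ∘ (Fin.last (Module.finrank ℂ W.C)).succAbove) = Fin.val := by
    funext j; simp
  have e2 : Complex.exp (-(x * (W.rootSum + z))) =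
      Complex.exp (-(x * W.rootSum)) * Complex.exp (-(x * z)) := by
    rw [← Complex.exp_add]; ring_nf
  rw [e] at h
  rw [gaugedWave, h, tau_eq_gaugedTau, gaugedTau, e2, zero_mul, add_zero]
  ring

/-- Uniqueness of the stationary wave function. -/
theorem Mem.eq_of_tendsto {f g : ℂ → ℂ} {x : ℂ} (hx : W.tau x 0 ≠ 0) (hf : W.Mem f)
    (hflim : Tendsto (fun z => f z * Complex.exp (-(x * z))) (cobounded ℂ) (𝓝 1))
    (hg : W.Mem g)
    (hglim : Tendsto (fun z => g z * Complex.exp (-(x * z))) (cobounded ℂ) (𝓝 1))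
    {z : ℂ} (hz : W.q.eval z ≠ 0) : f z = g z := by
  have h := (hf.mul_tau_eq_gaugedWave hflim hz).trans (hg.mul_tau_eq_gaugedWave hglim hz).symm
  exact mul_right_cancel₀ (Complex.exp_ne_zero _) (mul_right_cancel₀ hz (mul_right_cancel₀ hx h))

variable (W) in
/-- Where the tau function does not vanish, the coefficients of the wave function solve a regular
system of linear equations. -/
theorem exists_isWaveFunction : ∃ ψ, W.IsWaveFunction ψ := by
  have key (x : ℂ) : ∃ f : ℂ → ℂ, W.tau x 0 ≠ 0 → W.Mem f ∧
      Tendsto (fun z => f z * Complex.exp (-(x * z))) (cobounded ℂ) (𝓝 1) := by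
    by_cases hx : W.tau x 0 = 0
    · exact ⟨0, fun h => absurd hx h⟩
    set N := Module.finrank ℂ W.C with hN
    set A : Matrix (Fin (Module.finrank ℂ W.C)) (Fin (Module.finrank ℂ W.C)) ℂ :=
      Matrix.of fun i j => (W.cond i).apply (powExp j x 0) with hA
    have hdet : IsUnit A.det := by
      rw [isUnit_iff_ne_zero]
      intro h
      refine hx ?_
      rw [tau_eq_gaugedTau, gaugedTau]
      exact mul_eq_zero_of_right _ h
    set s := A⁻¹.mulVec fun i => -(W.cond i).apply (powExp N x 0) with hs
    have hAs : A.mulVec s = fun i => -(W.cond i).apply (powExp N x 0) := by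
      rw [hs, Matrix.mulVec_mulVec, Matrix.mul_nonsing_inv _ hdet, Matrix.one_mulVec]
    set F : ℂ → ℂ := fun z => ∑ j, Fin.snoc (α := fun _ => ℂ) s 1 j * powExp j x 0 z with hF
    set p : ℂ[X] := ∑ j : Fin N, Polynomial.C (s j) * Polynomial.X ^ (j : ℕ) with hp
    have hpdeg : p.degree < N := by
      refine (Polynomial.degree_sum_le _ _).trans_lt ((Finset.sup_lt_iff (WithBot.bot_lt_coe _)).mpr
        fun j _ => (Polynomial.degree_C_mul_X_pow_le _ _).trans_lt ?_)
      exact_mod_cast j.2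
    have hFp (z : ℂ) : F z * Complex.exp (-(x * z)) = z ^ N + p.eval z := by
      have h1 : Complex.exp (x * z) * Complex.exp (-(x * z)) = 1 := by
        rw [← Complex.exp_add, add_neg_cancel, Complex.exp_zero]
      have h2 : F z = (z ^ N + p.eval z) * Complex.exp (x * z) := by
        simp only [hF, hp, Fin.sum_univ_castSucc, Fin.snoc_castSucc, Fin.snoc_last, powExp,
          Polynomial.eval_finsetSum, Fin.val_last, Fin.val_castSucc, zero_mul, add_zero, one_mul]
        rw [add_mul, Finset.sum_mul, add_comm]
        simp [mul_assoc]
        rfl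
      rw [h2, mul_assoc, h1, mul_one]
    refine ⟨fun z => F z / W.q.eval z, fun _ => ⟨⟨F, ?_, ?_, fun z _ => rfl⟩, ?_⟩⟩
    · simp only [hF]
      have (j : ℕ) : Differentiable ℂ (powExp j x 0) :=
        (contDiff_powExp (n := 1) j x 0).differentiable one_ne_zero
      fun_prop
    · refine W.apply_eq_zero_of_cond fun i => ?_
      rw [hF, Condition.apply_sum_powExp, Fin.sum_univ_castSucc]
      have h := congrFun hAs i
      simp only [Matrix.mulVec, dotProduct, hA, Matrix.of_apply] at h
      simp only [Fin.snoc_castSucc, Fin.snoc_last, Fin.val_castSucc, Fin.val_last, one_mul]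
      rw [Finset.sum_congr rfl fun j _ => mul_comm _ _, h, neg_add_cancel]
    · rw [tendsto_cexp_mul_iff (F := F) fun z _ => rfl]
      simp only [hFp]
      have hNq : W.q.natDegree = N := W.natDegree_eq
      have h1 := ((tendsto_eval_div_pow hpdeg).const_add 1)
      have h2 := (tendsto_monic_eval_div_pow W.monic).inv₀ one_ne_zero
      simp only [inv_div, inv_one, hNq] at h2
      rw [add_zero] at h1
      refine tendsto_mul_ratio (P := fun z => z ^ N) (h1.congr' ?_) h2
      filter_upwards [(Bornology.le_cofinite ℂ)
        (Set.finite_singleton (0 : ℂ)).compl_mem_cofinite] with z hz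
      have hz' : z ^ N ≠ 0 := pow_ne_zero _ hz
      field_simp
  choose ψ hψ using key
  exact ⟨ψ, hψ⟩

end DualPoint

/-! ### Residues -/

section Residues

variable {ι κ : Type*} [Fintype ι] [Fintype κ]

theorem tendsto_mul_sum_div (x a : ι → ℂ) (w : ℂ) :
    Tendsto (fun z => (z - w) * ∑ i, a i / (z - x i)) (𝓝[≠] w)
      (𝓝 (∑ i, if x i = w then a i else 0)) := by
  simp only [Finset.mul_sum]
  refine tendsto_finsetSum _ fun i _ => ?_
  split_ifs with h
  · refine tendsto_const_nhds.congr' ?_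
    filter_upwards [self_mem_nhdsWithin] with z hz
    have hz' : z - w ≠ 0 := sub_ne_zero.mpr hz
    rw [h, mul_div_cancel₀ _ hz']
  · have hc : ContinuousAt (fun z => (z - w) * (a i / (z - x i))) w := by
      have : w - x i ≠ 0 := sub_ne_zero.mpr fun e => h e.symm
      fun_prop (disch := assumption)
    have h0 := hc.tendsto
    simp only [sub_self, zero_mul] at h0
    exact h0.mono_left nhdsWithin_le_nhds

/-- Equal rational functions with simple poles have the same residue at every point `w`. -/
theorem residue_eq_of_eventually_eq {x a : ι → ℂ} {y b : κ → ℂ}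
    (h : ∀ᶠ z in cofinite, ∑ i, a i / (z - x i) = ∑ j, b j / (z - y j)) (w : ℂ) :
    (∑ i, if x i = w then a i else 0) = ∑ j, if y j = w then b j else 0 := by
  refine tendsto_nhds_unique (tendsto_mul_sum_div x a w)
    ((tendsto_mul_sum_div y b w).congr' ?_)
  filter_upwards [(nhdsNE_le_cofinite w) h] with z hz
  rw [hz]

theorem sum_ite_node {x : ι → ℂ} (hx : Function.Injective x) (a : ι → ℂ) (i : ι) :
    (∑ j, if x j = x i then a j else 0) = a i := by
  classical
  rw [Fintype.sum_eq_single i fun j hj => if_neg fun h => hj (hx h), if_pos rfl]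

theorem eq_of_eventually_sum_div_eq {x a b : ι → ℂ} (hx : Function.Injective x)
    (h : ∀ᶠ z in cofinite, ∑ i, a i / (z - x i) = ∑ i, b i / (z - x i)) : a = b := by
  funext i
  have := residue_eq_of_eventually_eq h (x i)
  rwa [sum_ite_node hx, sum_ite_node hx] at this

theorem range_subset_of_eventually_sum_div_eq {x a : ι → ℂ} {y b : κ → ℂ}
    (hx : Function.Injective x) (ha : ∀ i, a i ≠ 0)
    (h : ∀ᶠ z in cofinite, ∑ i, a i / (z - x i) = ∑ j, b j / (z - y j)) (i : ι) :
    ∃ j, y j = x i := by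
  by_contra! hne
  have := residue_eq_of_eventually_eq h (x i)
  rw [sum_ite_node hx, Finset.sum_eq_zero fun j _ => if_neg (hne j)] at this
  exact ha i this

end Residues

/-! ### Poles of the wave function and the particle system -/

namespace DualPoint

variable {ι : Type*} [Fintype ι] [DecidableEq ι] {W : DualPoint}

/-- First-order form of the particle system: `tau W x 0` has the simple zeros `X i`, and
differentiating `tau W (x_i(t)) t = 0` gives them the velocities `2 Y i`. -/
structure HasParticles (W : DualPoint) (X Y : ι → ℂ) : Prop where
  injective : Function.Injective X
  tau_eq : ∃ a : ℂ, a ≠ 0 ∧ ∀ x, W.tau x 0 = a * nodal X x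
  deriv_tau : ∀ i, deriv (fun t => W.tau (X i) t) 0 =
    -(2 * Y i) * deriv (fun x => W.tau x 0) (X i)

omit [DecidableEq ι] in
theorem HasParticles.tau_ne_zero_iff {X Y : ι → ℂ} (h : W.HasParticles X Y) (x : ℂ) :
    W.tau x 0 ≠ 0 ↔ ∀ i, x ≠ X i := by
  obtain ⟨a, ha, hτ⟩ := h.tau_eq
  rw [hτ, ← nodal_ne_zero_iff]
  simp [ha]

/-- Krichever's pole expansion: if the wave function is asymptotic to `exp (x z)` as `x → ∞`, its
poles in `x` are the particle positions, and the bilinear equation at these poles is the linear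
system of the Calogero-Moser matrix. -/
theorem HasParticles.exists_cmSystem {X Y : ι → ℂ} (h : W.HasParticles X Y) {ψ : ℂ → ℂ → ℂ}
    (hψ : W.IsWaveFunction ψ) {z : ℂ} (hz : W.q.eval z ≠ 0)
    (hlim : Tendsto (fun x => ψ x z * Complex.exp (-(x * z))) (cobounded ℂ) (𝓝 1)) :
    ∃ a, CMSystem X Y z a ∧ ∀ x, (∀ i, x ≠ X i) →
      ψ x z = Complex.exp (x * z) * (1 + ∑ i, a i / (x - X i)) := by
  obtain ⟨a₀, ha₀, hτ⟩ := h.tau_eq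
  set κ := a₀ * W.q.eval z with hκ
  have hκ0 : κ ≠ 0 := mul_ne_zero ha₀ hz
  set B := gaugedWave W.cond W.rootSum z with hB
  have hBd : Differentiable ℂ B := differentiable_gaugedWave _ _ _
  have hψB (x : ℂ) (hx : ∀ i, x ≠ X i) : ψ x z * Complex.exp (-(x * z)) * (κ * nodal X x) = B x := by
    obtain ⟨h1, h2⟩ := hψ x ((h.tau_ne_zero_iff x).mpr hx)
    rw [hB, ← h1.mul_tau_eq_gaugedWave h2 hz, hτ]
    ring
  -- The function `B` is entire, and `B / (κ ∏ (x - X i))` is the normalized wave function.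
  obtain ⟨a, ha⟩ := exists_eq_numerator h.injective (F := fun x => κ⁻¹ * B x) (by fun_prop) (by
    refine hlim.congr' ?_
    filter_upwards [eventually_ne_cobounded X] with x hx
    have hn := (nodal_ne_zero_iff X x).mpr hx
    rw [← hψB x hx]
    field_simp)
  have hBN : B = fun x => κ * numerator X a x := by
    funext x
    rw [← congrFun ha x, mul_inv_cancel_left₀ hκ0]
  refine ⟨a, fun i => ?_, fun x hx => ?_⟩
  · have hπ := nodalErase_ne_zero h.injective i
    have hτd : (fun x => W.tau x 0) = fun x => a₀ * nodal X x := funext hτ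
    have dτ (x : ℂ) : deriv (fun x => W.tau x 0) x = a₀ * deriv (nodal X) x := by
      rw [hτd, deriv_const_mul _ (differentiable_nodal X x)]
    have ddτ : deriv (deriv fun x => W.tau x 0) (X i) = a₀ * deriv (deriv (nodal X)) (X i) := by
      rw [funext dτ, deriv_const_mul]
      exact ((differentiable_nodal X).analyticAt _).deriv.differentiableAt
    have dB : deriv B (X i) = κ * deriv (numerator X a) (X i) := by
      rw [hBN, deriv_const_mul _ (differentiable_numerator X a _)]
    have h0 : W.tau (X i) 0 = 0 := by rw [hτ, nodal_apply_node, mul_zero]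
    have h1 : deriv (fun x => W.tau x 0) (X i) ≠ 0 := by
      rw [dτ, deriv_nodal_node]
      exact mul_ne_zero ha₀ hπ
    have hbil := gaugedWave_bilinear W.cond W.rootSum W.rootSqSum (X i) z
    simp only [← tau_eq_gaugedTau] at hbil
    have hbil := hbil h0 h1
    rw [← hB, ddτ, h.deriv_tau i, dτ, dB, deriv_deriv_nodal_node h.injective, deriv_nodal_node,
      deriv_numerator_node h.injective, hBN] at hbil
    simp only [numerator_apply_node] at hbil
    have hc : 2 * κ * a₀ * nodalErase X i (X i) * nodalErase X i (X i) ≠ 0 := by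
      simp [hκ0, ha₀, hπ]
    refine mul_left_cancel₀ hc ?_
    linear_combination -hbil
  · have h1 := hψB x hx
    have hn := (nodal_ne_zero_iff X x).mpr hx
    rw [hBN] at h1
    simp only [numerator_eq_mul X a hx] at h1
    have h2 : ψ x z * Complex.exp (-(x * z)) = 1 + ∑ i, a i / (x - X i) := by
      refine mul_right_cancel₀ (mul_ne_zero hκ0 hn) (h1.trans ?_)
      ring
    rw [← h2, mul_comm, mul_assoc, ← Complex.exp_add, neg_add_cancel, Complex.exp_zero, mul_one]

/-- The chain rule, applied to `tau W (ξ t) t = 0`, gives the velocities. -/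
theorem HasParticleSystem.hasParticles {n : ℕ} {X Y : Fin n → ℂ} (hX : Function.Injective X)
    (h : W.HasParticleSystem (ParticleSystem.ofVectors X Y hX)) : W.HasParticles X Y := by
  obtain ⟨ξ, hτ, hξ⟩ := h
  have hinj : Function.Injective fun i => (X i, Y i) := fun i j hij => hX (congrArg Prod.fst hij)
  have hprod (t x : ℂ) : ∏ p ∈ (ParticleSystem.ofVectors X Y hX).particles, (x - ξ p t) =
      ∏ i, (x - ξ (X i, Y i) t) := by
    rw [ParticleSystem.ofVectors, Finset.prod_image fun i _ j _ hij => hinj hij]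
  have hmem (i) : (X i, Y i) ∈ (ParticleSystem.ofVectors X Y hX).particles :=
    Finset.mem_image_of_mem _ (Finset.mem_univ i)
  refine ⟨hX, ?_, fun i => ?_⟩
  · obtain ⟨a, ha, h0⟩ := hτ.self_of_nhds
    refine ⟨a, ha, fun x => ?_⟩
    rw [h0, hprod, nodal]
    congr 1
    exact Finset.prod_congr rfl fun i _ => by rw [(hξ _ (hmem i)).1]
  · obtain ⟨h1, h2⟩ := hξ _ (hmem i)
    have hd := (W.hasStrictFDerivAt_tau (X i, 0)).hasFDerivAt
    have hc := HasFDerivAt.comp_hasDerivAt_of_eq (x := (0 : ℂ)) hd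
      (h2.prodMk (hasDerivAt_id (0 : ℂ))) (by simp [h1])
    have hzero : (fun p : ℂ × ℂ => W.tau p.1 p.2) ∘ (fun t => (ξ (X i, Y i) t, id t)) =ᶠ[𝓝 0]
        fun _ => 0 := by
      filter_upwards [hτ] with t ⟨a, _, ht⟩
      rw [Function.comp_apply, id, ht, hprod, Finset.prod_eq_zero (Finset.mem_univ i) (sub_self _),
        mul_zero]
    have := (hc.congr_of_eventuallyEq hzero.symm).unique (hasDerivAt_const (0 : ℂ) (0 : ℂ))
    simp only [partials_apply] at this
    linear_combination this

end DualPoint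

theorem ParticleSystem.exists_eq_ofVectors (S : ParticleSystem) :
    ∃ (n : ℕ) (X Y : Fin n → ℂ) (hX : Function.Injective X), S = ofVectors X Y hX := by
  set e := S.particles.equivFin.symm
  refine ⟨_, fun i => (e i : ℂ × ℂ).1, fun i => (e i : ℂ × ℂ).2, fun i j hij => ?_, ?_⟩
  · exact e.injective (Subtype.ext (S.injOn (e i).2 (e j).2 hij))
  · ext p
    simp only [ofVectors, Finset.mem_image, Finset.mem_univ, true_and]
    refine ⟨fun hp => ⟨e.symm ⟨p, hp⟩, by simp⟩, ?_⟩
    rintro ⟨i, rfl⟩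
    exact (e i).2

/-! ### The points with cusp conditions -/

/-- The momenta `γ_i + ∑ j ≠ i, 1 / (λ_i - λ_j)`. -/
noncomputable def momenta {n : ℕ} (lam gam : Fin n → ℂ) (i : Fin n) : ℂ :=
  gam i + ∑ j ∈ Finset.univ.erase i, 1 / (lam i - lam j)

theorem momenta_sub {n : ℕ} (lam mu : Fin n → ℂ) :
    momenta lam (fun i => mu i - ∑ j ∈ Finset.univ.erase i, 1 / (lam i - lam j)) = mu := by
  funext i
  simp [momenta]

namespace DualPoint

variable {n : ℕ} {lam gam : Fin n → ℂ} {hlam : Function.Injective lam}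

theorem q_ofCoordinates (z : ℂ) : (ofCoordinates lam gam hlam).q.eval z = nodal lam z := by
  rw [nodal_eq_eval]
  rfl

theorem q_ofCoordinates_ne_zero_iff (z : ℂ) :
    (ofCoordinates lam gam hlam).q.eval z ≠ 0 ↔ ∀ i, z ≠ lam i := by
  rw [q_ofCoordinates, nodal_ne_zero_iff]

theorem isBispectral_ofCoordinates : (ofCoordinates lam gam hlam).IsBispectral := by
  refine ⟨n, lam, fun i => cuspCondition (lam i) (gam i),
    linearIndependent_cuspCondition lam gam hlam, fun i => ?_, rfl, rfl⟩
  exact add_mem (Submodule.subset_span ⟨1, rfl⟩)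
    (Submodule.smul_mem _ _ (Submodule.subset_span ⟨0, rfl⟩))

theorem mem_C_ofCoordinates_iff (F : ℂ → ℂ) :
    (∀ c ∈ (ofCoordinates lam gam hlam).C, Condition.apply c F = 0) ↔
      ∀ i, (cuspCondition (lam i) (gam i)).apply F = 0 := by
  refine ⟨fun h i => h _ (Submodule.subset_span ⟨i, rfl⟩), fun h => ?_⟩
  have : (ofCoordinates lam gam hlam).C ≤ LinearMap.ker (Condition.eval F) := by
    refine Submodule.span_le.mpr ?_
    rintro _ ⟨i, rfl⟩
    exact h i
  exact fun c hc => this hc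

theorem apply_cuspCondition_numerator (hlam : Function.Injective lam) (x : ℂ) (b : Fin n → ℂ)
    (i : Fin n) :
    (cuspCondition (lam i) (gam i)).apply (fun z => numerator lam b z * Complex.exp (x * z)) =
      Complex.exp (x * lam i) * nodalErase lam i (lam i) *
        ((x + momenta lam gam i) * b i +
          ∑ j ∈ Finset.univ.erase i, b j / (lam i - lam j) + 1) := by
  have h := (differentiable_numerator lam b (lam i)).hasDerivAt.mul
    ((hasDerivAt_id (lam i)).const_mul x).cexp
  rw [apply_cuspCondition]
  refine (congrArg (· + _) h.deriv).trans ?_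
  simp only [id, numerator_apply_node, deriv_numerator_node hlam, momenta]
  ring

/-- The cusp condition at `λ_i`, applied to a function with pole expansion `b`, is the `i`-th row of
the linear system. -/
theorem forall_apply_cuspCondition_iff (hlam : Function.Injective lam) (x : ℂ) (b : Fin n → ℂ) :
    (∀ i, (cuspCondition (lam i) (gam i)).apply
      (fun z => numerator lam b z * Complex.exp (x * z)) = 0) ↔
      CMSystem lam (momenta lam gam) x b := by
  refine forall_congr' fun i => ?_
  rw [apply_cuspCondition_numerator hlam, mul_eq_zero, or_iff_right
    (mul_ne_zero (Complex.exp_ne_zero _) (nodalErase_ne_zero hlam i)), add_eq_zero_iff_eq_neg]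

/-- The pole expansion in `z` of the wave function: the cusp conditions are the linear system of
the Calogero-Moser matrix. -/
theorem exists_cmSystem_ofCoordinates {ψ : ℂ → ℂ → ℂ}
    (hψ : (ofCoordinates lam gam hlam).IsWaveFunction ψ) {x : ℂ}
    (hx : (ofCoordinates lam gam hlam).tau x 0 ≠ 0) :
    ∃ b, CMSystem lam (momenta lam gam) x b ∧ ∀ z, (∀ i, z ≠ lam i) →
      ψ x z = Complex.exp (x * z) * (1 + ∑ i, b i / (z - lam i)) := by
  obtain ⟨⟨F, hF, hC, hfF⟩, hlim⟩ := hψ x hx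
  rw [tendsto_cexp_mul_iff hfF] at hlim
  simp only [q_ofCoordinates] at hlim
  obtain ⟨b, hb⟩ := exists_eq_numerator hlam (by fun_prop) hlim
  have hFb : F = fun z => numerator lam b z * Complex.exp (x * z) := by
    funext z
    rw [← congrFun hb z, mul_assoc, ← Complex.exp_add, neg_add_cancel, Complex.exp_zero, mul_one]
  refine ⟨b, ?_, fun z hz => ?_⟩
  · rw [← forall_apply_cuspCondition_iff hlam, ← hFb]
    exact (mem_C_ofCoordinates_iff F).mp hC
  · have hn := (nodal_ne_zero_iff lam z).mpr hz
    rw [hfF z ((q_ofCoordinates_ne_zero_iff z).mpr hz), hFb, q_ofCoordinates]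
    simp only [numerator_eq_mul lam b hz]
    field_simp

theorem mem_ofCoordinates_of_cmSystem {x : ℂ} {b : Fin n → ℂ}
    (hb : CMSystem lam (momenta lam gam) x b) {f : ℂ → ℂ}
    (hf : ∀ z, (∀ i, z ≠ lam i) → f z = Complex.exp (x * z) * (1 + ∑ i, b i / (z - lam i))) :
    (ofCoordinates lam gam hlam).Mem f ∧
      Tendsto (fun z => f z * Complex.exp (-(x * z))) (cobounded ℂ) (𝓝 1) := by
  have hd := differentiable_numerator lam b
  have hfF (z : ℂ) (hz : (ofCoordinates lam gam hlam).q.eval z ≠ 0) :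
      f z = numerator lam b z * Complex.exp (x * z) / (ofCoordinates lam gam hlam).q.eval z := by
    have hz' := (q_ofCoordinates_ne_zero_iff z).mp hz
    have hn := (nodal_ne_zero_iff lam z).mpr hz'
    rw [hf z hz', q_ofCoordinates, numerator_eq_mul lam b hz']
    field_simp
  refine ⟨⟨_, by fun_prop, ?_, hfF⟩, ?_⟩
  · rw [mem_C_ofCoordinates_iff, forall_apply_cuspCondition_iff hlam]
    exact hb
  · rw [tendsto_cexp_mul_iff hfF]
    refine (tendsto_numerator_div_nodal lam b).congr fun z => ?_
    rw [mul_assoc, ← Complex.exp_add, add_neg_cancel, Complex.exp_zero, mul_one, q_ofCoordinates]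

/-- The tau function does not depend, up to a constant, on the basis of the space of conditions. -/
theorem exists_tau_eq_mul_wronskian (W : DualPoint) {m : ℕ} (c : Fin m → Condition)
    (hc : LinearIndependent ℂ c) (hW : W.C = Submodule.span ℂ (Set.range c)) :
    ∃ κ : ℂ, κ ≠ 0 ∧ ∀ x t, W.tau x t =
      κ * (Complex.exp (-(x * W.rootSum + t * W.rootSqSum)) * wronskian c Fin.val x t) := by
  have := W.finiteDimensional
  have hm : m = Module.finrank ℂ W.C := by
    rw [hW, finrank_span_eq_card hc, Fintype.card_fin]
  subst hm
  set b : Module.Basis (Fin (Module.finrank ℂ W.C)) ℂ W.C :=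
    (Module.Basis.span hc).map (LinearEquiv.ofEq _ _ hW.symm) with hb
  have hbc (i) : (b i : Condition) = c i := by
    simp [hb, Module.Basis.span_apply]
  set P := b.toMatrix (Module.finBasis ℂ W.C) with hP
  have hPdet : P.det ≠ 0 := by
    have h := b.toMatrix_mul_toMatrix_flip (Module.finBasis ℂ W.C)
    intro h0
    have h1 := congrArg Matrix.det h
    rw [Matrix.det_mul, ← hP, h0, zero_mul, Matrix.det_one] at h1
    exact zero_ne_one h1
  refine ⟨P.det, hPdet, fun x t => ?_⟩
  have hcond (i) : W.cond i = ∑ k, P k i • c k := by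
    have h := congrArg Subtype.val (b.sum_toMatrix_smul_self (Module.finBasis ℂ W.C) i)
    rw [Submodule.coe_sum] at h
    simp only [Submodule.coe_smul, hbc] at h
    exact h.symm
  have hmat : (Matrix.of fun i j : Fin (Module.finrank ℂ W.C) => (W.cond i).apply (powExp j x t)) =
      P.transpose *
      Matrix.of fun i j : Fin (Module.finrank ℂ W.C) => (c i).apply (powExp j x t) := by
    ext i j
    rw [Matrix.mul_apply, Matrix.of_apply, hcond, ← Condition.eval_apply, map_sum]
    simp
  rw [tau_eq_gaugedTau, gaugedTau, wronskian, hmat, Matrix.det_mul, Matrix.det_transpose, wronskian]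
  ring

theorem apply_cuspCondition_powExp (lam gam : ℂ) (j : ℕ) (x t : ℂ) :
    (cuspCondition lam gam).apply (powExp j x t) = Complex.exp (x * lam + t * lam ^ 2) *
      (j * lam ^ (j - 1) + lam ^ j * (gam + 2 * t * lam) + x * lam ^ j) := by
  rw [apply_cuspCondition, deriv_powExp]
  simp only [powExp]
  ring

/-- In the gauge `q = ∏ (z - λ_i)` the tau function is, up to a constant, a characteristic
polynomial in `x`. -/
theorem exists_tau_ofCoordinates_eq (hlam : Function.Injective lam) :
    ∃ κ : ℂ, κ ≠ 0 ∧ ∀ t, ∃ p : ℂ[X], p.Monic ∧ p.natDegree = n ∧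
      ∀ x, (ofCoordinates lam gam hlam).tau x t = κ * p.eval x := by
  obtain ⟨κ, hκ, hτ⟩ := exists_tau_eq_mul_wronskian (ofCoordinates lam gam hlam) _
    (linearIndependent_cuspCondition lam gam hlam) rfl
  have hV : (Matrix.vandermonde lam).det ≠ 0 := Matrix.det_vandermonde_ne_zero_iff.mpr hlam
  refine ⟨κ * (Matrix.vandermonde lam).det, mul_ne_zero hκ hV, fun t => ?_⟩
  set N : Matrix (Fin n) (Fin n) ℂ := Matrix.of fun i j =>
    (j : ℕ) * lam i ^ ((j : ℕ) - 1) + lam i ^ (j : ℕ) * (gam i + 2 * t * lam i) with hN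
  refine ⟨(-(N * (Matrix.vandermonde lam)⁻¹)).charpoly, Matrix.charpoly_monic _, ?_, fun x => ?_⟩
  · rw [Matrix.charpoly_natDegree_eq_dim, Fintype.card_fin]
  have hroots : (ofCoordinates lam gam hlam).q.roots = Finset.univ.val.map lam := by
    have h := Polynomial.roots_multiset_prod_X_sub_C (Finset.univ.val.map lam)
    rw [Multiset.map_map] at h
    exact h
  have hexp : Complex.exp (-(x * (ofCoordinates lam gam hlam).rootSum +
      t * (ofCoordinates lam gam hlam).rootSqSum)) *
      ∏ i, Complex.exp (x * lam i + t * lam i ^ 2) = 1 := by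
    have h1 : (ofCoordinates lam gam hlam).rootSum = ∑ i, lam i := by
      rw [rootSum, hroots]
      rfl
    have h2 : (ofCoordinates lam gam hlam).rootSqSum = ∑ i, lam i ^ 2 := by
      rw [rootSqSum, hroots, Multiset.map_map]
      rfl
    rw [h1, h2, ← Complex.exp_sum, Finset.sum_add_distrib, ← Finset.mul_sum, ← Finset.mul_sum,
      ← Complex.exp_add, neg_add_cancel, Complex.exp_zero]
  have hw : wronskian (fun i => cuspCondition (lam i) (gam i)) Fin.val x t =
      (∏ i, Complex.exp (x * lam i + t * lam i ^ 2)) *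
        (N + x • Matrix.vandermonde lam).det := by
    rw [← Matrix.det_mul_column, wronskian]
    congr 1
    ext i j
    rw [Matrix.of_apply, Matrix.of_apply, apply_cuspCondition_powExp]
    simp [hN, Matrix.vandermonde_apply]
  have hdet : (N + x • Matrix.vandermonde lam).det =
      (-(N * (Matrix.vandermonde lam)⁻¹)).charpoly.eval x * (Matrix.vandermonde lam).det := by
    rw [Matrix.eval_charpoly, ← Matrix.det_mul, sub_neg_eq_add, add_mul, Matrix.mul_assoc,
      Matrix.nonsing_inv_mul _ (isUnit_iff_ne_zero.mpr hV), Matrix.mul_one, add_comm]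
    congr 2
    ext i j
    simp
  rw [hτ, hw, hdet, ← mul_assoc (Complex.exp _), hexp]
  ring

end DualPoint

/-! ### Motion of the zeros of the tau function -/

theorem monic_eval_eq_nodal {n : ℕ} {X : Fin n → ℂ} (hX : Function.Injective X) {p : ℂ[X]}
    (hp : p.Monic) (hdeg : p.natDegree = n) (h : ∀ i, p.eval (X i) = 0) (z : ℂ) :
    p.eval z = nodal X z := by
  set q : ℂ[X] := ∏ i, (Polynomial.X - Polynomial.C (X i)) with hq
  have hqm : q.Monic := Polynomial.monic_prod_of_monic _ _ fun i _ => Polynomial.monic_X_sub_C _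
  have hqd : q.natDegree = n := by simp [q]
  have hlt : (p - q).degree < p.degree := by
    refine Polynomial.degree_sub_lt_left ?_ hp.ne_zero ?_
    · rw [Polynomial.degree_eq_natDegree hp.ne_zero, Polynomial.degree_eq_natDegree hqm.ne_zero,
        hdeg, hqd]
    · rw [hp.leadingCoeff, hqm.leadingCoeff]
  have h0 : p - q = 0 := by
    by_contra hne
    refine hne (Polynomial.eq_zero_of_natDegree_lt_card_of_eval_eq_zero _ hX (fun i => ?_) ?_)
    · rw [Polynomial.eval_sub, h, hq, ← nodal_eq_eval, nodal_apply_node, sub_zero]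
    · rw [Fintype.card_fin, ← hdeg]
      exact Polynomial.natDegree_lt_natDegree hne hlt
  rw [sub_eq_zero.mp h0, nodal_eq_eval]

namespace DualPoint

variable {W : DualPoint} {n : ℕ} {X Y : Fin n → ℂ}

theorem HasParticles.deriv_tau_ne_zero (h : W.HasParticles X Y) (i : Fin n) :
    deriv (fun x => W.tau x 0) (X i) ≠ 0 := by
  obtain ⟨a, ha, hτ⟩ := h.tau_eq
  rw [funext hτ, deriv_const_mul _ (differentiable_nodal X _), deriv_nodal_node]
  exact mul_ne_zero ha (nodalErase_ne_zero h.injective i)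

/-- A simple zero of `tau W x 0` extends to a differentiable zero of `tau W x t`, by the implicit
function theorem. -/
theorem HasParticles.exists_branch (h : W.HasParticles X Y) (i : Fin n) :
    ∃ ξ : ℂ → ℂ, ξ 0 = X i ∧ HasDerivAt ξ (2 * Y i) 0 ∧ ∀ᶠ t in 𝓝 0, W.tau (ξ t) t = 0 := by
  have h1 := h.deriv_tau_ne_zero i
  have h2 := h.deriv_tau i
  have hstrict := W.hasStrictFDerivAt_tau (X i, 0)
  simp only at hstrict
  set α := deriv (fun x => W.tau x 0) (X i)
  set β := deriv (fun t => W.tau (X i) t) 0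
  have hτ0 : W.tau (X i) 0 = 0 := by
    obtain ⟨a, ha, hτ⟩ := h.tau_eq
    rw [hτ, nodal_apply_node, mul_zero]
  have hf : HasStrictFDerivAt (fun p : ℂ × ℂ => W.tau p.2 p.1) (partials β α) ((0 : ℂ), X i) := by
    have hswap : HasStrictFDerivAt (fun p : ℂ × ℂ => (p.2, p.1))
        ((ContinuousLinearMap.snd ℂ ℂ ℂ).prod (ContinuousLinearMap.fst ℂ ℂ ℂ)) ((0 : ℂ), X i) :=
      hasStrictFDerivAt_snd.prodMk hasStrictFDerivAt_fst
    refine (HasStrictFDerivAt.comp (g := fun p : ℂ × ℂ => W.tau p.1 p.2) ((0 : ℂ), X i) hstrict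
      hswap).congr_fderiv ?_
    ext <;> simp
  have hinv : (partials β α ∘L ContinuousLinearMap.inr ℂ ℂ ℂ).IsInvertible := by
    refine ⟨ContinuousLinearEquiv.unitsEquivAut ℂ (Units.mk0 α h1), ?_⟩
    ext
    simp
  have hξ0 : hf.implicitFunctionOfProdDomain hinv 0 = X i :=
    (hf.eventually_apply_eq_iff_implicitFunctionOfProdDomain hinv).self_of_nhds.mp rfl
  have hξt := hf.eventually_apply_implicitFunctionOfProdDomain hinv
  obtain ⟨d, hξd⟩ : ∃ d, HasDerivAt (hf.implicitFunctionOfProdDomain hinv) d 0 :=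
    ⟨_, (hf.hasStrictFDerivAt_implicitFunctionOfProdDomain hinv).hasStrictDerivAt.hasDerivAt⟩
  simp only [hτ0] at hξt
  set ξ := hf.implicitFunctionOfProdDomain hinv
  refine ⟨ξ, hξ0, ?_, hξt⟩
  have hc := HasFDerivAt.comp_hasDerivAt_of_eq (x := (0 : ℂ)) hstrict.hasFDerivAt
      (hξd.prodMk (hasDerivAt_id (0 : ℂ))) (by simp [hξ0])
  have := (hc.congr_of_eventuallyEq (f₁ := fun _ => 0) (hξt.mono fun t ht => ht.symm)).unique
    (hasDerivAt_const (0 : ℂ) (0 : ℂ))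
  simp only [partials_apply, h2] at this
  refine hξd.congr_deriv (mul_left_cancel₀ h1 ?_)
  linear_combination this

/-- If `x ↦ tau W x t` is a polynomial of degree `n` for every `t`, then its `n` simple zeros move
differentiably, by the implicit function theorem. -/
theorem HasParticles.hasParticleSystem (h : W.HasParticles X Y) {κ : ℂ} (hκ : κ ≠ 0)
    (hp : ∀ t, ∃ p : ℂ[X], p.Monic ∧ p.natDegree = n ∧ ∀ x, W.tau x t = κ * p.eval x) :
    W.HasParticleSystem (ParticleSystem.ofVectors X Y h.injective) := by
  choose ξ hξ0 hξd hξ using h.exists_branch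
  have hX := h.injective
  have hinj : Function.Injective fun i => (X i, Y i) := fun i j hij => hX (congrArg Prod.fst hij)
  have hdist : ∀ᶠ t in 𝓝 (0 : ℂ), Function.Injective fun i => ξ i t := by
    have h1 : ∀ᶠ t in 𝓝 (0 : ℂ), ∀ i j, i ≠ j → ξ i t ≠ ξ j t := by
      refine eventually_all.mpr fun i => eventually_all.mpr fun j => ?_
      by_cases hij : i = j
      · exact Eventually.of_forall fun t h => absurd hij h
      · filter_upwards [((hξd i).continuousAt.ne_iff_eventually_ne (hξd j).continuousAt).mp
          (by rw [hξ0, hξ0]; exact fun e => hij (hX e))] with t ht _ using ht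
    filter_upwards [h1] with t ht i j hij
    by_contra hne
    exact ht i j hne hij
  refine ⟨Function.extend (fun i => (X i, Y i)) ξ fun _ _ => 0, ?_, ?_⟩
  · filter_upwards [hdist, eventually_all.mpr hξ] with t ht hzero
    obtain ⟨p, hpm, hpd, hpτ⟩ := hp t
    refine ⟨κ, hκ, fun x => ?_⟩
    rw [hpτ, ParticleSystem.ofVectors, Finset.prod_image fun i _ j _ hij => hinj hij,
      monic_eval_eq_nodal ht hpm hpd (fun i => ?_)]
    · simp only [hinj.extend_apply, nodal]
    · have := hzero i
      rw [hpτ] at this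
      exact (mul_eq_zero.mp this).resolve_left hκ
  · intro q hq
    obtain ⟨i, -, rfl⟩ := Finset.mem_image.mp hq
    rw [hinj.extend_apply]
    exact ⟨hξ0 i, hξd i⟩

/-! ### Uniqueness of the image -/

section Dual

variable {W' : DualPoint} {ψ ψ' : ℂ → ℂ → ℂ} {n' : ℕ} {X' Y' : Fin n' → ℂ}

theorem eventually_q_ne_zero (W : DualPoint) : ∀ᶠ z in cofinite, W.q.eval z ≠ 0 :=
  (Polynomial.finite_setOfPred_isRoot W.monic.ne_zero).compl_mem_cofinite

theorem HasParticles.eventually_tau_ne_zero (h : W.HasParticles X Y) :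
    ∀ᶠ x in cofinite, W.tau x 0 ≠ 0 := by
  filter_upwards [(Set.finite_range X).compl_mem_cofinite] with x hx
  rw [h.tau_ne_zero_iff]
  exact fun i hi => hx ⟨i, hi.symm⟩

/-- Under the bispectral involution, the normalization of one wave function as `z → ∞` becomes that
of the other one as `x → ∞`. -/
theorem tendsto_of_dual (h : W.HasParticles X Y) (hψ' : W'.IsWaveFunction ψ')
    (hdual : ∀ x z, W'.tau x 0 ≠ 0 → W'.q.eval z ≠ 0 → W.tau z 0 ≠ 0 → W.q.eval x ≠ 0 →
      ψ' x z = ψ z x) {z : ℂ} (hz : W.q.eval z ≠ 0) (hz' : W'.tau z 0 ≠ 0) :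
    Tendsto (fun x => ψ x z * Complex.exp (-(x * z))) (cobounded ℂ) (𝓝 1) := by
  refine (hψ' z hz').2.congr' ?_
  filter_upwards [Bornology.le_cofinite ℂ h.eventually_tau_ne_zero,
    Bornology.le_cofinite ℂ W'.eventually_q_ne_zero] with x hx hx'
  rw [hdual z x hz' hx' hx hz, mul_comm z x]

/-- Both wave functions of a dual pair have pole expansions, and these are expansions of the same
function of `x` and `z`. -/
theorem IsBispectralDual.exists_expansions (hWW' : W.IsBispectralDual W')
    (h : W.HasParticles X Y) (h' : W'.HasParticles X' Y') :
    ∃ (a : ℂ → Fin n → ℂ) (b : ℂ → Fin n' → ℂ),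
      (∀ᶠ z in cofinite, CMSystem X Y z (a z)) ∧ (∀ᶠ x in cofinite, CMSystem X' Y' x (b x)) ∧
      ∀ᶠ x in cofinite, ∀ᶠ z in cofinite,
        ∑ i, a z i / (x - X i) = ∑ j, b x j / (z - X' j) := by
  obtain ⟨ψ, ψ', hψ, hψ', hdual⟩ := hWW'
  have h1 (z : ℂ) : ∃ a, W.q.eval z ≠ 0 → W'.tau z 0 ≠ 0 → CMSystem X Y z a ∧
      ∀ x, (∀ i, x ≠ X i) → ψ x z = Complex.exp (x * z) * (1 + ∑ i, a i / (x - X i)) := by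
    by_cases hz : W.q.eval z ≠ 0 ∧ W'.tau z 0 ≠ 0
    · obtain ⟨a, ha⟩ := h.exists_cmSystem hψ hz.1 (tendsto_of_dual h hψ' hdual hz.1 hz.2)
      exact ⟨a, fun _ _ => ha⟩
    · exact ⟨0, fun hz1 hz2 => absurd ⟨hz1, hz2⟩ hz⟩
  have h2 (x : ℂ) : ∃ b, W'.q.eval x ≠ 0 → W.tau x 0 ≠ 0 → CMSystem X' Y' x b ∧
      ∀ z, (∀ i, z ≠ X' i) → ψ' z x = Complex.exp (z * x) * (1 + ∑ i, b i / (z - X' i)) := by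
    by_cases hx : W'.q.eval x ≠ 0 ∧ W.tau x 0 ≠ 0
    · obtain ⟨b, hb⟩ := h'.exists_cmSystem hψ' hx.1 (tendsto_of_dual h' hψ
        (fun x z k1 k2 k3 k4 => (hdual z x k3 k4 k1 k2).symm) hx.1 hx.2)
      exact ⟨b, fun _ _ => hb⟩
    · exact ⟨0, fun hx1 hx2 => absurd ⟨hx1, hx2⟩ hx⟩
  choose a ha using h1
  choose b hb using h2
  refine ⟨a, b, ?_, ?_, ?_⟩
  · filter_upwards [W.eventually_q_ne_zero, h'.eventually_tau_ne_zero] with z hz hz'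
    exact (ha z hz hz').1
  · filter_upwards [W'.eventually_q_ne_zero, h.eventually_tau_ne_zero] with x hx hx'
    exact (hb x hx hx').1
  · filter_upwards [W'.eventually_q_ne_zero, h.eventually_tau_ne_zero] with x hx hx'
    filter_upwards [W.eventually_q_ne_zero, h'.eventually_tau_ne_zero] with z hz hz'
    have e1 := (ha z hz hz').2 x ((h.tau_ne_zero_iff x).mp hx')
    have e2 := (hb x hx hx').2 z ((h'.tau_ne_zero_iff z).mp hz')
    rw [hdual z x hz' hx hx' hz, e1, mul_comm z x] at e2
    exact add_left_cancel (mul_left_cancel₀ (Complex.exp_ne_zero _) e2)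

end Dual

/-- The particle system of `W` determines the wave function of `W`, hence the poles and residues of
the wave function of the dual point, hence the particle system of the dual point. -/
theorem ofVectors_eq_of_dual {W₁ W₁' W₂ W₂' : DualPoint} (hd₁ : W₁.IsBispectralDual W₁')
    (hd₂ : W₂.IsBispectralDual W₂') (h₁ : W₁.HasParticles X Y) (h₂ : W₂.HasParticles X Y)
    {n₁ n₂ : ℕ} {X₁ Y₁ : Fin n₁ → ℂ} {X₂ Y₂ : Fin n₂ → ℂ} (h₁' : W₁'.HasParticles X₁ Y₁)
    (h₂' : W₂'.HasParticles X₂ Y₂) :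
    ParticleSystem.ofVectors X₁ Y₁ h₁'.injective = ParticleSystem.ofVectors X₂ Y₂ h₂'.injective := by
  obtain ⟨a₁, b₁, ha₁, hb₁, hab₁⟩ := hd₁.exists_expansions h₁ h₁'
  obtain ⟨a₂, b₂, ha₂, hb₂, hab₂⟩ := hd₂.exists_expansions h₂ h₂'
  have haa : ∀ᶠ z in cofinite, a₁ z = a₂ z := by
    filter_upwards [ha₁, ha₂, eventually_cmSystem_unique X Y] with z k1 k2 hu
    exact hu _ _ k1 k2
  have hlarge (r : ℝ) : ∀ᶠ x in cobounded ℂ, r < ‖x‖ :=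
    tendsto_norm_cobounded_atTop.eventually_gt_atTop r
  have hle := Bornology.le_cofinite ℂ
  -- For such a large `x` all residues `b₁ x i` and `b₂ x j` are nonzero.
  obtain ⟨x, k1, k2, s1, s2, r1, r2⟩ := ((hab₁.filter_mono hle).and
    ((hab₂.filter_mono hle).and ((hb₁.filter_mono hle).and
    ((hb₂.filter_mono hle).and ((hlarge (2 * cmBound X₁ Y₁)).and
      (hlarge (2 * cmBound X₂ Y₂))))))).exists
  have hb : ∀ᶠ z in cofinite, ∑ i, b₁ x i / (z - X₁ i) = ∑ j, b₂ x j / (z - X₂ j) := by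
    filter_upwards [k1, k2, haa] with z e1 e2 e3
    rw [← e1, ← e2, e3]
  have n1 := s1.ne_zero r1
  have n2 := s2.ne_zero r2
  choose f hf using range_subset_of_eventually_sum_div_eq h₁'.injective n1 hb
  choose g hg using range_subset_of_eventually_sum_div_eq h₂'.injective n2 (hb.mono fun z h => h.symm)
  have hbij : Function.Bijective f := by
    refine ⟨fun i j hij => h₁'.injective (by rw [← hf, ← hf, hij]), fun j => ⟨g j, ?_⟩⟩
    exact h₂'.injective (by rw [hf, hg])
  have hbb (i) : b₁ x i = b₂ x (f i) := by
    have := residue_eq_of_eventually_eq hb (X₁ i)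
    rwa [sum_ite_node h₁'.injective, ← hf, sum_ite_node h₂'.injective] at this
  set e := Equiv.ofBijective f hbij
  have hY (i) : Y₂ (f i) = Y₁ i := by
    have q1 := s1 i
    have q2 := s2 (f i)
    have hs : ∑ j ∈ Finset.univ.erase i, b₁ x j / (X₁ i - X₁ j) =
        ∑ j ∈ Finset.univ.erase (f i), b₂ x j / (X₂ (f i) - X₂ j) := by
      refine Finset.sum_equiv e (fun j => ?_) fun j _ => ?_
      · simp [e, hbij.injective.eq_iff]
      · change _ = b₂ x (f j) / (X₂ (f i) - X₂ (f j))
        rw [hbb, hf, hf]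
    rw [hs, hbb] at q1
    refine mul_right_cancel₀ (n2 (f i)) ?_
    linear_combination q2 - q1
  ext p
  simp only [ParticleSystem.ofVectors, Finset.mem_image, Finset.mem_univ, true_and]
  constructor
  · rintro ⟨i, rfl⟩
    exact ⟨f i, by rw [hf, hY]⟩
  · rintro ⟨j, rfl⟩
    obtain ⟨i, rfl⟩ := hbij.surjective j
    exact ⟨i, by rw [hf, hY]⟩

/-! ### Existence of the image -/

theorem tendsto_of_cmSystem {lam mu : Fin n → ℂ} {b : ℂ → Fin n → ℂ}
    (h : ∀ᶠ x in cobounded ℂ, CMSystem lam mu x (b x)) : Tendsto b (cobounded ℂ) (𝓝 0) := by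
  have hn : Tendsto (fun x : ℂ => ‖x‖ - cmBound lam mu) (cobounded ℂ) atTop :=
    tendsto_atTop_add_const_right _ _ tendsto_norm_cobounded_atTop
  refine squeeze_zero_norm' ?_ hn.inv_tendsto_atTop
  filter_upwards [h, hn.eventually_gt_atTop 0] with x hx hpos
  rw [Pi.inv_apply, ← one_div, le_div_iff₀ hpos]
  linarith [hx.mul_norm_le]

section Existence

variable {m : ℕ} {lam gam : Fin n → ℂ} {hlam : Function.Injective lam} {X Y : Fin m → ℂ}

/-- As `x → ∞`, the residues `b_i(x)` of the wave function at the `λ_i` tend to zero. -/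
theorem tendsto_wave_ofCoordinates
    (h : (ofCoordinates lam gam hlam).HasParticles X Y) {ψ : ℂ → ℂ → ℂ}
    (hψ : (ofCoordinates lam gam hlam).IsWaveFunction ψ) {z : ℂ} (hz : ∀ i, z ≠ lam i) :
    Tendsto (fun x => ψ x z * Complex.exp (-(x * z))) (cobounded ℂ) (𝓝 1) := by
  have key (x : ℂ) : ∃ b, (ofCoordinates lam gam hlam).tau x 0 ≠ 0 →
      CMSystem lam (momenta lam gam) x b ∧ ∀ z, (∀ i, z ≠ lam i) →
        ψ x z = Complex.exp (x * z) * (1 + ∑ i, b i / (z - lam i)) := by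
    by_cases hx : (ofCoordinates lam gam hlam).tau x 0 ≠ 0
    · obtain ⟨b, hb⟩ := exists_cmSystem_ofCoordinates hψ hx
      exact ⟨b, fun _ => hb⟩
    · exact ⟨0, fun h => absurd h hx⟩
  choose b hb using key
  have hτ := h.eventually_tau_ne_zero.filter_mono (Bornology.le_cofinite ℂ)
  have hb0 := tendsto_pi_nhds.mp (tendsto_of_cmSystem (hτ.mono fun x hx => (hb x hx).1))
  have hs := (tendsto_finsetSum Finset.univ fun i _ =>
    (hb0 i).div_const (z - lam i)).const_add 1
  simp only [Pi.zero_apply, zero_div, Finset.sum_const_zero, add_zero] at hs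
  refine hs.congr' ?_
  filter_upwards [hτ] with x hx
  rw [(hb x hx).2 z hz, mul_right_comm, ← Complex.exp_add, add_neg_cancel, Complex.exp_zero,
    one_mul]

/-- The tau function has degree `n` in `x`, so there are `n` particles. -/
theorem card_particles_ofCoordinates (h : (ofCoordinates lam gam hlam).HasParticles X Y) :
    m = n := by
  obtain ⟨a, ha, hτ⟩ := h.tau_eq
  obtain ⟨κ, hκ, hp⟩ := exists_tau_ofCoordinates_eq (gam := gam) hlam
  obtain ⟨p, hpm, hpd, hpτ⟩ := hp 0
  have e : Polynomial.C a * ∏ i, (Polynomial.X - Polynomial.C (X i)) = Polynomial.C κ * p := by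
    refine Polynomial.funext fun x => ?_
    rw [Polynomial.eval_C_mul, Polynomial.eval_C_mul, ← nodal_eq_eval, ← hτ, hpτ]
  have e' := congrArg Polynomial.natDegree e
  rw [Polynomial.natDegree_C_mul ha, Polynomial.natDegree_C_mul hκ, hpd] at e'
  simpa using e'

/-- The momenta that turn the particle system `(X, Y)` into dual coordinates. -/
noncomputable def dualMomenta (X Y : Fin m → ℂ) (i : Fin m) : ℂ :=
  Y i - ∑ j ∈ Finset.univ.erase i, 1 / (X i - X j)

/-- The pole expansion in `x` of the wave function of `(λ, γ)` and the pole expansion in `z` of the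
wave function of the dual point are governed by the same Calogero-Moser matrix. -/
theorem wave_ofCoordinates_dual (h : (ofCoordinates lam gam hlam).HasParticles X Y)
    {ψ ψ' : ℂ → ℂ → ℂ} (hψ : (ofCoordinates lam gam hlam).IsWaveFunction ψ)
    (hψ' : (ofCoordinates X (dualMomenta X Y) h.injective).IsWaveFunction ψ') {x z : ℂ}
    (hx : (ofCoordinates X (dualMomenta X Y) h.injective).tau x 0 ≠ 0)
    (hz : (ofCoordinates X (dualMomenta X Y) h.injective).q.eval z ≠ 0)
    (hx' : (ofCoordinates lam gam hlam).q.eval x ≠ 0) : ψ' x z = ψ z x := by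
  obtain ⟨a, ha, hψa⟩ := h.exists_cmSystem hψ hx'
    (tendsto_wave_ofCoordinates h hψ ((q_ofCoordinates_ne_zero_iff x).mp hx'))
  have hm : momenta X (dualMomenta X Y) = Y := momenta_sub X Y
  rw [← hm] at ha
  obtain ⟨h1, h2⟩ := mem_ofCoordinates_of_cmSystem (hlam := h.injective) ha
    (f := fun z => ψ z x) fun z hz => by rw [hψa z hz, mul_comm z x]
  exact (hψ' x hx).1.eq_of_tendsto hx (hψ' x hx).2 h1 h2 hz

theorem isBispectralDual_ofCoordinates (h : (ofCoordinates lam gam hlam).HasParticles X Y) :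
    (ofCoordinates lam gam hlam).IsBispectralDual
      (ofCoordinates X (dualMomenta X Y) h.injective) := by
  obtain ⟨ψ, hψ⟩ := (ofCoordinates lam gam hlam).exists_isWaveFunction
  obtain ⟨ψ', hψ'⟩ := (ofCoordinates X (dualMomenta X Y) h.injective).exists_isWaveFunction
  exact ⟨ψ, ψ', hψ, hψ', fun x z hx hz _ hx' => wave_ofCoordinates_dual h hψ hψ' hx hz hx'⟩

/-- The wave function of the dual point has poles in `x` exactly at the `λ_i`, because its residues
there do not vanish for large `z`, and the linear system for the residues gives the momenta. -/
theorem hasParticles_dual {X Y : Fin n → ℂ} (h : (ofCoordinates lam gam hlam).HasParticles X Y) :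
    (ofCoordinates X (dualMomenta X Y) h.injective).HasParticles lam (momenta lam gam) := by
  set W := ofCoordinates lam gam hlam with hW
  set W' := ofCoordinates X (dualMomenta X Y) h.injective with hW'
  obtain ⟨ψ, hψ⟩ := W.exists_isWaveFunction
  obtain ⟨ψ', hψ'⟩ := W'.exists_isWaveFunction
  have hle := Bornology.le_cofinite ℂ
  -- For such a large `z` all residues `b i` of `ψ z` at the `λ_i` are nonzero.
  obtain ⟨z, hzτ, hzq, hzK⟩ := ((h.eventually_tau_ne_zero.filter_mono hle).and
    ((W'.eventually_q_ne_zero.filter_mono hle).and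
      (tendsto_norm_cobounded_atTop.eventually_gt_atTop
        (2 * cmBound lam (momenta lam gam))))).exists
  obtain ⟨b, hb, hψb⟩ := exists_cmSystem_ofCoordinates hψ hzτ
  have hb0 := hb.ne_zero hzK
  have hψ'b (x : ℂ) (hx : W'.tau x 0 ≠ 0) (hxl : ∀ i, x ≠ lam i) :
      ψ' x z = Complex.exp (x * z) * (1 + ∑ i, b i / (x - lam i)) := by
    rw [wave_ofCoordinates_dual h hψ hψ' hx hzq ((q_ofCoordinates_ne_zero_iff x).mpr hxl),
      hψb x hxl, mul_comm z x]
  -- If the tau function did not vanish at `λ_i`, the wave function would be regular there.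
  have hτ0 (i) : W'.tau (lam i) 0 = 0 := by
    by_contra hne
    set B := gaugedWave W'.cond W'.rootSum z with hB
    have hBc : Continuous B := (differentiable_gaugedWave _ _ _).continuous
    have hτc : Continuous fun x => W'.tau x 0 := (W'.differentiable_tau 0).continuous
    have hnc := (differentiable_nodal lam).continuous
    have hNc := (differentiable_numerator lam b).continuous
    have hev : (fun x => W'.q.eval z * (W'.tau x 0 * numerator lam b x)) =ᶠ[𝓝[≠] lam i]
        fun x => B x * nodal lam x := by
      filter_upwards [nhdsWithin_le_nhds (hτc.continuousAt.eventually_ne hne),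
        nhdsNE_le_cofinite (lam i) (Set.finite_range lam).compl_mem_cofinite] with x hx hxl
      have hxl' : ∀ j, x ≠ lam j := fun j hj => hxl ⟨j, hj.symm⟩
      obtain ⟨m1, m2⟩ := hψ' x hx
      rw [hB, ← m1.mul_tau_eq_gaugedWave m2 hzq, hψ'b x hx hxl', numerator_eq_mul lam b hxl']
      have : Complex.exp (x * z) * Complex.exp (-(x * z)) = 1 := by
        rw [← Complex.exp_add, add_neg_cancel, Complex.exp_zero]
      linear_combination (-(1 + ∑ i, b i / (x - lam i)) * W'.q.eval z * W'.tau x 0 *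
        nodal lam x) * this
    have l1 : Tendsto (fun x => W'.q.eval z * (W'.tau x 0 * numerator lam b x)) (𝓝[≠] lam i)
        (𝓝 (W'.q.eval z * (W'.tau (lam i) 0 * numerator lam b (lam i)))) :=
      ((continuous_const.mul (hτc.mul hNc)).tendsto (lam i)).mono_left nhdsWithin_le_nhds
    have l2 : Tendsto (fun x => B x * nodal lam x) (𝓝[≠] lam i)
        (𝓝 (B (lam i) * nodal lam (lam i))) :=
      ((hBc.mul hnc).tendsto (lam i)).mono_left nhdsWithin_le_nhds
    have := tendsto_nhds_unique (l1.congr' hev) l2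
    rw [nodal_apply_node, mul_zero, numerator_apply_node] at this
    simp [hzq, hne, hb0 i, nodalErase_ne_zero hlam i] at this
  obtain ⟨κ, hκ, hp⟩ := exists_tau_ofCoordinates_eq (gam := dualMomenta X Y) h.injective
  obtain ⟨p, hpm, hpd, hpτ⟩ := hp 0
  have hτeq (x : ℂ) : W'.tau x 0 = κ * nodal lam x := by
    rw [hpτ, monic_eval_eq_nodal hlam hpm hpd fun i => ?_]
    have := hτ0 i
    rw [hpτ] at this
    exact (mul_eq_zero.mp this).resolve_left hκ
  have hd0 (i) : deriv (fun x => W'.tau x 0) (lam i) ≠ 0 := by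
    rw [funext hτeq, deriv_const_mul _ (differentiable_nodal lam _), deriv_nodal_node]
    exact mul_ne_zero hκ (nodalErase_ne_zero hlam i)
  set Y' : Fin n → ℂ := fun i =>
    -(deriv (fun t => W'.tau (lam i) t) 0 / (2 * deriv (fun x => W'.tau x 0) (lam i))) with hY'
  have h' : W'.HasParticles lam Y' := by
    refine ⟨hlam, ⟨κ, hκ, hτeq⟩, fun i => ?_⟩
    have := hd0 i
    simp only [hY']
    field_simp
  obtain ⟨a, ha, hψa⟩ := h'.exists_cmSystem hψ' hzq (by
    refine (tendsto_numerator_div_nodal lam b).congr' ?_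
    filter_upwards [eventually_ne_cobounded lam] with x hx
    rw [hψ'b x ((h'.tau_ne_zero_iff x).mpr hx) hx, numerator_eq_mul lam b hx,
      mul_div_cancel_left₀ _ ((nodal_ne_zero_iff lam x).mpr hx), mul_right_comm,
      ← Complex.exp_add, add_neg_cancel, Complex.exp_zero, one_mul])
  have hab : a = b := by
    refine eq_of_eventually_sum_div_eq hlam ?_
    filter_upwards [(Set.finite_range lam).compl_mem_cofinite] with x hxl
    have hx : ∀ j, x ≠ lam j := fun j hj => hxl ⟨j, hj.symm⟩
    have e := (hψa x hx).symm.trans (hψ'b x ((h'.tau_ne_zero_iff x).mpr hx) hx)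
    exact add_left_cancel (mul_left_cancel₀ (Complex.exp_ne_zero _) e)
  have hYm : Y' = momenta lam gam := by
    funext i
    have e1 := ha i
    have e2 := hb i
    rw [hab] at e1
    refine mul_right_cancel₀ (hb0 i) ?_
    linear_combination e1 - e2
  rwa [← hYm]

end Existence

end DualPoint

end CalogeroMoser

theorem mainTheorem2 (n : ℕ) (lam gam : Fin n → ℂ) (hlam : Function.Injective lam)
    (S : CalogeroMoser.ParticleSystem)
    (hS : (CalogeroMoser.DualPoint.ofCoordinates lam gam hlam).HasParticleSystem S)
    (S' : CalogeroMoser.ParticleSystem) :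
    CalogeroMoser.BispectralInvolution S S' ↔
      S' = CalogeroMoser.ParticleSystem.ofVectors lam
        (fun i => gam i + ∑ j ∈ Finset.univ.erase i, 1 / (lam i - lam j)) hlam := by
  obtain ⟨m, X, Y, hX, rfl⟩ := S.exists_eq_ofVectors
  have h := CalogeroMoser.DualPoint.HasParticleSystem.hasParticles hX hS
  obtain rfl := CalogeroMoser.DualPoint.card_particles_ofCoordinates h
  have hdual := CalogeroMoser.DualPoint.isBispectralDual_ofCoordinates h
  have h' := CalogeroMoser.DualPoint.hasParticles_dual h
  constructor
  · rintro ⟨W, W', -, -, hWW', hW, hW'⟩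
    obtain ⟨m', X', Y', hX', rfl⟩ := S'.exists_eq_ofVectors
    exact CalogeroMoser.DualPoint.ofVectors_eq_of_dual hWW' hdual
      (CalogeroMoser.DualPoint.HasParticleSystem.hasParticles hX hW) h
      (CalogeroMoser.DualPoint.HasParticleSystem.hasParticles hX' hW') h'
  · rintro rfl
    obtain ⟨κ, hκ, hp⟩ := CalogeroMoser.DualPoint.exists_tau_ofCoordinates_eq
      (gam := CalogeroMoser.DualPoint.dualMomenta X Y) hX
    exact ⟨_, _, CalogeroMoser.DualPoint.isBispectral_ofCoordinates,
      CalogeroMoser.DualPoint.isBispectral_ofCoordinates, hdual, hS,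
      h'.hasParticleSystem hκ hp⟩
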